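/- Let $\mathbb N=\{1,2,3,\dots\}$, $D=\{(i,j)\in\mathbb N\times\mathbb N : i\ge j\}$, and let $G$ be the vector lattice of all finitely supported functions $x:D\to\mathbb R$ (pointwise operations and order). Let $$B=\{b=(b_i)\in c_{00} : i\,b_i\in\mathbb N\cup\{0\}\text{ for all } i,\ \|b\|_2\le 1\},$$ and for $b\in B$ let $x_b\in G$ be given by $x_b(i,j)=1$ if $1\le j\le i\,b_i$ and $x_b(i,j)=0$ otherwise. Let $U$ be the convex solid hull of $\{x_b: b\in B\}$, i.e. the smallest convex solid subset of $G$ containing all $x_b$ (a set $S$ is solid if $y\in S$ whenever $|y|\le|x|$ and $x\in S$). For $x\in G$ put $$\rho(x)=\Bigl\|\Bigl(\tfrac1i\sum_{j=1}^i|x(i,j)|\Bigr)_{i=1}^\infty\Bigr\|_2 ,$$ and call $x,y\in G$ row disjoint if $\sum_{j=1}^i|x(i,j)|\cdot\sum_{j=1}^i|y(i,j)|=0$ for every $i$. For a finite real sequence $a=(a_1,\dots,a_m)$ let $\|a\|_{p,\infty}=\max_{n}a_n^*n^{1/p}$, where $(a_n^*)$ is the decreasing rearrangement of $(|a_n|)$.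 Fix $1<p<2$ and let $$A=\{y_1+\dots+y_m : m\in\mathbb N,\ y_1,\dots,y_m\in U \text{ pairwise row disjoint},\ \|(\rho(y_1),\dots,\rho(y_m))\|_{p,\infty}\le 1\}.$$ Let $V$ be the convex hull of $A$ and let $\tau$ be the gauge (Minkowski) functional of $V$; it is a norm on $G$. Let $E$ be the completion of $(G,\tau)$. Theorem. For every $1<p<2$ the real Banach space $E$ has the following properties. 1. Let $(y_n)_{n\ge1}$ be a sequence in $G\subseteq E$ of $\tau$-normalized ($\tau(y_n)=1$), pairwise disjoint ($|y_m|\wedge|y_n|=0$ for $m\ne n$) elements with $\|y_n\|_\infty=\sup_{d\in D}|y_n(d)|\to0$. Then $(y_n)$ has a subsequence $(y_{n_k})$ equivalent to the unit vector basis of $c_0$, i.e. there are constants $c,C>0$ with $c\max_k|a_k|\le\bigl\|\sum_k a_ky_{n_k}\bigr\|\le C\max_k|a_k|$ for all finitely supported real sequences $(a_k)$. 2. $E$ is $c_0$-saturated: every closed infinite dimensional subspace of $E$ contains a subspace isomorphic to $c_0$. 3. The unit vectors $e_d$, $d\in D$ (the characteristic functions of the points of $D$), form an unconditional basis of $E$.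 4. $E$ has a quotient space isomorphic to $\ell^2$: there is a closed subspace $N\subseteq E$ such that $E/N$ is linearly homeomorphic to $\ell^2$. In particular, there is a $c_0$-saturated Banach space with an unconditional basis which has a quotient space isomorphic to $\ell^2$. -/

import Mathlib

open Filter Topology
open scoped ZeroAtInfty

noncomputable section

namespace Leung

/-- The index set `D = {(i, j) : i, j ∈ {1, 2, 3, …}, i ≥ j}`. -/
abbrev D : Type := {d : ℕ+ × ℕ+ // d.2 ≤ d.1}

/-- The vector lattice `G` of finitely supported functions `D → ℝ`
(pointwise operations and order). -/
abbrev G : Type := D →₀ ℝ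

/-- The `ℓ²`-norm of a finitely supported sequence. -/
def l2norm (a : ℕ+ → ℝ) : ℝ := Real.sqrt (∑' i, a i ^ 2)

/-- The set `B` of all `b ∈ c₀₀` with `i bᵢ ∈ ℕ ∪ {0}` for all `i` and `‖b‖₂ ≤ 1`. -/
def B : Set (ℕ+ →₀ ℝ) :=
  {b | (∀ i : ℕ+, ∃ n : ℕ, (i : ℝ) * b i = n) ∧ l2norm b ≤ 1}

lemma finite_support_xb (b : ℕ+ →₀ ℝ) :
    (Function.support fun d : D =>
      if ((d.1.2 : ℕ+) : ℝ) ≤ (d.1.1 : ℝ) * b d.1.1 then (1 : ℝ) else 0).Finite := by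
  have hfin := Finset.finite_toSet (b.support.biUnion fun i =>
    (Finset.Iic i).image fun j => ((i, j) : ℕ+ × ℕ+))
  refine Set.Finite.subset (hfin.preimage (Subtype.val_injective (p := fun d : ℕ+ × ℕ+ =>
    d.2 ≤ d.1)).injOn) ?_
  rintro ⟨⟨i, j⟩, hij⟩ hd
  simp only [Function.mem_support, ne_eq, ite_eq_right_iff, one_ne_zero, imp_false,
    not_not] at hd
  simp only [Set.mem_preimage]
  have hb : b i ≠ 0 := by
    intro h0
    rw [h0, mul_zero] at hd
    have : (0 : ℝ) < (j : ℕ) := by exact_mod_cast j.pos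
    linarith
  simp [hb, hij]

/-- The element `x_b` of `G`: `x_b(i, j) = 1` if `1 ≤ j ≤ i bᵢ`, and `0` otherwise. -/
def xb (b : ℕ+ →₀ ℝ) : G := Finsupp.ofSupportFinite _ (finite_support_xb b)

/-- `U` is the convex solid hull of `{x_b : b ∈ B}`: the smallest convex and solid subset
of `G` that contains every `x_b`, `b ∈ B`. -/
def U : Set G :=
  ⋂₀ {S | Convex ℝ S ∧ LatticeOrderedAddCommGroup.IsSolid S ∧ ∀ b ∈ B, xb b ∈ S}

/-- `∑_{j=1}^{i} |x(i, j)|`. -/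
def rowSum (x : G) (i : ℕ+) : ℝ := ∑ j : Set.Iic i, |x ⟨(i, j.1), j.2⟩|

/-- The seminorm `ρ(x) = ‖(i⁻¹ ∑_{j=1}^{i} |x(i, j)|)ᵢ‖₂`. -/
def rho (x : G) : ℝ := l2norm fun i => 1 / (i : ℝ) * rowSum x i

/-- Row disjointness of two elements of `G`. -/
def RowDisjoint (x y : G) : Prop := ∀ i : ℕ+, rowSum x i * rowSum y i = 0

/-- The decreasing rearrangement of `(|a₁|, …, |aₘ|)`; the `n`-th entry (counting from `0`). -/
def decRearr {m : ℕ} (a : Fin m → ℝ) (n : Fin m) : ℝ :=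
  |a (Tuple.sort (fun k => -|a k|) n)|

/-- The Lorentz "norm" `‖(a₁, …, aₘ)‖_{p,∞} = maxₙ aₙ* n^{1/p}` of a finite sequence. -/
def lorentz (p : ℝ) {m : ℕ} (a : Fin m → ℝ) : ℝ :=
  ⨆ n : Fin m, decRearr a n * ((n : ℝ) + 1) ^ (1 / p)

/-- The set `A = {y₁ + ⋯ + yₘ}` with `y₁, …, yₘ ∈ U` pairwise row disjoint and
`‖(ρ(y₁), …, ρ(yₘ))‖_{p,∞} ≤ 1`. -/
def A (p : ℝ) : Set G :=
  {x | ∃ (m : ℕ) (y : Fin m → G), 0 < m ∧ (∀ k, y k ∈ U) ∧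
    (Pairwise fun k l => RowDisjoint (y k) (y l)) ∧
    lorentz p (fun k => rho (y k)) ≤ 1 ∧ x = ∑ k, y k}

/-- `V` is the convex hull of `A`. -/
def V (p : ℝ) : Set G := convexHull ℝ (A p)

/-- `τ` is the gauge functional (Minkowski functional) of `V`. -/
def tau (p : ℝ) (x : G) : ℝ := gauge (V p) x

/-! Facts needed to see that `τ` is a norm. -/

lemma abs_apply (x : G) (d : D) : |x| d = |x d| := by
  simp [abs, Finsupp.sup_apply]

lemma convex_U : Convex ℝ U := convex_sInter fun _ hS => hS.1

lemma solid_U : LatticeOrderedAddCommGroup.IsSolid U := fun _ hx _ hy S hS =>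
  hS.2.1 (hx S hS) hy

lemma xb_mem_U {b : ℕ+ →₀ ℝ} (hb : b ∈ B) : xb b ∈ U := fun _ hS => hS.2.2 b hb

lemma neg_mem_U {x : G} (hx : x ∈ U) : -x ∈ U := solid_U hx (by simp)

lemma abs_le_one_of_mem_U {x : G} (hx : x ∈ U) (d : D) : |x d| ≤ 1 := by
  refine hx {y | ∀ d, |y d| ≤ 1} ⟨?_, ?_, ?_⟩ d
  · intro y hy z hz s t hs ht hst d
    calc |(s • y + t • z) d| ≤ |s * y d| + |t * z d| := by
          simpa using abs_add_le (s * y d) (t * z d)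
      _ = s * |y d| + t * |z d| := by rw [abs_mul, abs_mul, abs_of_nonneg hs, abs_of_nonneg ht]
      _ ≤ s * 1 + t * 1 := by gcongr; exacts [hy d, hz d]
      _ = 1 := by linarith
  · intro y hy z hz d
    have := hz d
    rw [abs_apply, abs_apply] at this
    exact this.trans (hy d)
  · intro b _ d
    change |if _ then (1 : ℝ) else 0| ≤ 1
    split_ifs <;> simp

lemma rowSum_nonneg (x : G) (i : ℕ+) : 0 ≤ rowSum x i :=
  Finset.sum_nonneg fun _ _ => abs_nonneg _

lemma rowSum_neg (x : G) (i : ℕ+) : rowSum (-x) i = rowSum x i := by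
  simp [rowSum]

lemma rho_neg (x : G) : rho (-x) = rho x := by
  simp [rho, rowSum_neg]

lemma apply_eq_zero_of_rowSum {x : G} {d : D} (h : rowSum x d.1.1 = 0) : x d = 0 := by
  rw [rowSum, Finset.sum_eq_zero_iff_of_nonneg fun _ _ => abs_nonneg _] at h
  simpa using h ⟨d.1.2, d.2⟩ (Finset.mem_univ _)

lemma neg_mem_A {p : ℝ} {x : G} (hx : x ∈ A p) : -x ∈ A p := by
  obtain ⟨m, y, hm, hU, hrow, hl, rfl⟩ := hx
  refine ⟨m, fun k => -y k, hm, fun k => neg_mem_U (hU k), fun k l hkl i => ?_, ?_, by simp⟩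
  · simpa [rowSum_neg] using hrow hkl i
  · simpa [rho_neg] using hl

lemma abs_le_one_of_mem_A {p : ℝ} {x : G} (hx : x ∈ A p) (d : D) : |x d| ≤ 1 := by
  obtain ⟨m, y, -, hU, hrow, -, rfl⟩ := hx
  rw [Finsupp.finsetSum_apply]
  by_cases h : ∃ k, rowSum (y k) d.1.1 ≠ 0
  · obtain ⟨k, hk⟩ := h
    rw [Finset.sum_eq_single k]
    · exact abs_le_one_of_mem_U (hU k) d
    · intro l _ hlk
      exact apply_eq_zero_of_rowSum ((mul_eq_zero.1 (hrow hlk d.1.1)).resolve_right hk)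
    · simp
  · push Not at h
    rw [Finset.sum_eq_zero fun k _ => apply_eq_zero_of_rowSum (h k)]
    simp

lemma abs_le_one_of_mem_V {p : ℝ} {x : G} (hx : x ∈ V p) (d : D) : |x d| ≤ 1 := by
  have hc : Convex ℝ {y : G | |y d| ≤ 1} := by
    intro y hy z hz s t hs ht hst
    simp only [Set.mem_ofPred_eq] at hy hz ⊢
    calc |(s • y + t • z) d| ≤ |s * y d| + |t * z d| := by
          simpa using abs_add_le (s * y d) (t * z d)
      _ = s * |y d| + t * |z d| := by rw [abs_mul, abs_mul, abs_of_nonneg hs, abs_of_nonneg ht]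
      _ ≤ s * 1 + t * 1 := by gcongr
      _ = 1 := by linarith
  exact convexHull_min (fun y hy => abs_le_one_of_mem_A hy d) hc hx

lemma single_mem_U (d : D) : Finsupp.single d (1 : ℝ) ∈ U := by
  classical
  have hb : Finsupp.single d.1.1 (1 : ℝ) ∈ B := by
    refine ⟨fun i => ?_, ?_⟩
    · by_cases h : d.1.1 = i
      · exact ⟨i, by simp [h]⟩
      · exact ⟨0, by simp [h]⟩
    · rw [l2norm, tsum_eq_single d.1.1 fun i hi => by
        simp [Finsupp.single_eq_of_ne hi]]
      simp
  refine solid_U (xb_mem_U hb) fun e => ?_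
  rw [abs_apply, abs_apply]
  by_cases h : e = d
  · subst h
    have : xb (Finsupp.single e.1.1 (1 : ℝ)) e = 1 := by
      refine if_pos ?_
      have := e.2
      simpa using this
    simp [this]
  · simp [Finsupp.single_eq_of_ne h]

lemma rho_single_le (d : D) : rho (Finsupp.single d (1 : ℝ)) ≤ 1 := by
  classical
  have h0 : ∀ i, i ≠ d.1.1 → rowSum (Finsupp.single d (1 : ℝ)) i = 0 := fun i hi =>
    Finset.sum_eq_zero fun j _ => by
      rw [Finsupp.single_eq_of_ne, abs_zero]
      intro h
      exact hi (congrArg (fun e : D => e.1.1) h)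
  have h1 : rowSum (Finsupp.single d (1 : ℝ)) d.1.1 = 1 := by
    rw [rowSum, Finset.sum_eq_single ⟨d.1.2, d.2⟩]
    · simp
    · intro j _ hj
      rw [Finsupp.single_eq_of_ne, abs_zero]
      intro h
      exact hj (Subtype.ext (congrArg (fun e : D => e.1.2) h))
    · simp
  rw [rho, l2norm, tsum_eq_single d.1.1 fun i hi => by simp [h0 i hi], h1, mul_one]
  rw [Real.sqrt_sq (by positivity), one_div]
  exact inv_le_one_of_one_le₀ (by exact_mod_cast d.1.1.pos)

lemma single_mem_V (p : ℝ) (d : D) : Finsupp.single d (1 : ℝ) ∈ V p := by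
  refine subset_convexHull ℝ _ ⟨1, fun _ => Finsupp.single d 1, one_pos, fun _ => single_mem_U d,
    fun k l hkl => absurd (Subsingleton.elim k l) hkl, ?_, by simp⟩
  refine ciSup_le fun n => ?_
  have hn : (n : ℕ) = 0 := by omega
  have h0 : 0 ≤ rho (Finsupp.single d (1 : ℝ)) := Real.sqrt_nonneg _
  simpa [decRearr, hn, abs_of_nonneg h0] using rho_single_le d

lemma neg_mem_V {p : ℝ} {x : G} (hx : x ∈ V p) : -x ∈ V p := by
  have : -V p ⊆ V p := by
    rw [V, ← convexHull_neg]
    exact convexHull_mono fun y hy => by simpa using neg_mem_A hy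
  exact this (by simpa using hx)

lemma zero_mem_V (p : ℝ) : (0 : G) ∈ V p := by
  have h := single_mem_V p ⟨(1, 1), le_rfl⟩
  have := (convex_convexHull ℝ (A p)) h (neg_mem_V h) (by norm_num : (0 : ℝ) ≤ 1 / 2)
    (by norm_num : (0 : ℝ) ≤ 1 / 2) (by norm_num)
  rw [smul_neg, add_neg_cancel] at this
  exact this

lemma balanced_V (p : ℝ) : Balanced ℝ (V p) := by
  refine balanced_iff_smul_mem.2 fun {r} hr x hx => ?_
  have hc : Convex ℝ (V p) := convex_convexHull ℝ _
  rw [Real.norm_eq_abs] at hr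
  rcases le_total 0 r with h | h
  · exact hc.smul_mem_of_zero_mem (zero_mem_V p) hx ⟨h, (le_abs_self r).trans hr⟩
  · have := hc.smul_mem_of_zero_mem (zero_mem_V p) (neg_mem_V hx) (t := -r)
      ⟨by linarith, (neg_le_abs r).trans hr⟩
    simpa using this

lemma absorbent_V (p : ℝ) : Absorbent ℝ (V p) := by
  have hc : Convex ℝ (V p) := convex_convexHull ℝ _
  have key : ∀ x : G, ∃ c : ℝ, 0 < c ∧ c • x ∈ V p := by
    intro x
    induction x using Finsupp.induction_linear with
    | zero => exact ⟨1, one_pos, by simpa using zero_mem_V p⟩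
    | add x y hx hy =>
      obtain ⟨c, hc0, hcx⟩ := hx
      obtain ⟨e, he0, hey⟩ := hy
      refine ⟨c * e / (c + e), by positivity, ?_⟩
      have := hc hcx hey (a := e / (c + e)) (b := c / (c + e)) (by positivity) (by positivity)
        (by field_simp; ring)
      rw [smul_smul, smul_smul] at this
      rw [smul_add]
      convert this using 3 <;> ring
    | single d r =>
      refine ⟨1 / (|r| + 1), by positivity, ?_⟩
      have := (balanced_V p).smul_mem (a := r / (|r| + 1)) (by
        rw [Real.norm_eq_abs, abs_div, abs_of_pos (by positivity : 0 < |r| + 1)]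
        exact div_le_one_of_le₀ (by linarith) (by positivity)) (single_mem_V p d)
      rw [Finsupp.smul_single, smul_eq_mul, mul_one] at this
      rw [Finsupp.smul_single, smul_eq_mul, one_div_mul_eq_div]
      exact this
  refine fun x => ?_
  obtain ⟨c, hc0, hcx⟩ := key x
  refine Absorbs.of_norm ⟨c⁻¹, fun a ha => ?_⟩
  have ha0 : a ≠ 0 := by
    rintro rfl
    rw [norm_zero] at ha
    exact absurd ha (not_le.2 (inv_pos.2 hc0))
  rw [Set.singleton_subset_iff, Set.mem_smul_set_iff_inv_smul_mem₀ ha0]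
  have h1 : a⁻¹ • x = (a⁻¹ * c⁻¹) • c • x := by
    rw [smul_smul, mul_assoc, inv_mul_cancel₀ hc0.ne', mul_one]
  rw [h1]
  refine (balanced_V p).smul_mem ?_ hcx
  rw [norm_mul, norm_inv, Real.norm_of_nonneg (inv_pos.2 hc0).le, ← div_eq_inv_mul]
  exact div_le_one_of_le₀ ha (norm_nonneg _)

lemma abs_apply_le_tau (p : ℝ) (x : G) (d : D) : |x d| ≤ tau p x := by
  rw [tau, gauge_def]
  obtain ⟨r, hr, hx⟩ := (absorbent_V p).gauge_set_nonempty (x := x)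
  refine le_csInf ⟨r, hr, hx⟩ ?_
  rintro s ⟨hs, y, hy, rfl⟩
  have hs' : (0 : ℝ) < s := hs
  have := abs_le_one_of_mem_V hy d
  simp only [Finsupp.smul_apply, smul_eq_mul, abs_mul, abs_of_pos hs']
  nlinarith

/-- The space `G` equipped with the norm `τ`. -/
def Gtau (_p : ℝ) : Type := G

instance (p : ℝ) : AddCommGroup (Gtau p) := inferInstanceAs (AddCommGroup G)

instance (p : ℝ) : Module ℝ (Gtau p) := inferInstanceAs (Module ℝ G)

instance (p : ℝ) : Norm (Gtau p) := ⟨fun x => tau p x⟩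

lemma tau_core (p : ℝ) : NormedSpace.Core ℝ (Gtau p) where
  norm_nonneg x := gauge_nonneg (s := V p) (E := G) x
  norm_smul c x := gauge_smul (E := G) (balanced_V p) c x
  norm_triangle x y := gauge_add_le (E := G) (convex_convexHull ℝ _) (absorbent_V p) x y
  norm_eq_zero_iff x := by
    constructor
    · intro h
      have h' : tau p x = 0 := h
      exact Finsupp.ext (g := (0 : G)) fun d =>
        abs_nonpos_iff.1 ((abs_apply_le_tau p x d).trans_eq h')
    · rintro rfl
      exact gauge_zero (E := G)

instance (p : ℝ) : NormedAddCommGroup (Gtau p) := NormedAddCommGroup.ofCore (tau_core p)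

instance (p : ℝ) : NormedSpace ℝ (Gtau p) := NormedSpace.ofCore (tau_core p)

/-- The Banach space `E`: the completion of `(G, τ)`. -/
abbrev E (p : ℝ) : Type := UniformSpace.Completion (Gtau p)

/-- The canonical linear embedding of `G` into `E`. -/
def toE (p : ℝ) : G →ₗ[ℝ] E p :=
  (UniformSpace.Completion.toComplₗᵢ : Gtau p →ₗᵢ[ℝ] E p).toLinearMap

lemma norm_toE (p : ℝ) (x : G) : ‖toE p x‖ = tau p x :=
  (UniformSpace.Completion.toComplₗᵢ : Gtau p →ₗᵢ[ℝ] E p).norm_map x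

/-- The sup-norm on `G`. -/
def supNorm (x : G) : ℝ := ⨆ d : D, |x d|

/-- The sequence `x` is equivalent to the unit vector basis of `c₀`: for some constants
`c, C > 0`, `c maxₖ |aₖ| ≤ ‖∑ₖ aₖ xₖ‖ ≤ C maxₖ |aₖ|` for all finitely supported scalars. -/
def EquivC0Basis {X : Type*} [NormedAddCommGroup X] [NormedSpace ℝ X] (x : ℕ → X) : Prop :=
  ∃ c C : ℝ, 0 < c ∧ 0 < C ∧ ∀ a : ℕ →₀ ℝ,
    c * (⨆ k, |a k|) ≤ ‖a.sum fun k t => t • x k‖ ∧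
    ‖a.sum fun k t => t • x k‖ ≤ C * (⨆ k, |a k|)

/-- A Banach space is `c₀`-saturated if each of its closed infinite dimensional subspaces
contains an isomorph of `c₀` (here `C₀(ℕ, ℝ)`, the real null sequences with the sup-norm). -/
def C0Saturated (X : Type*) [NormedAddCommGroup X] [NormedSpace ℝ X] : Prop :=
  ∀ Y : Submodule ℝ X, IsClosed (Y : Set X) → ¬ FiniteDimensional ℝ Y →
    ∃ Z : Submodule ℝ X, Z ≤ Y ∧ Nonempty (C₀(ℕ, ℝ) ≃L[ℝ] Z)

end Leung

end

/-!
The seminorm `ρ` dominates the `ℓ²`-norm of the sequence of row averages. On a sum of row disjoint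
parts `ρ²` is subadditive, so the weak `ℓᵖ` condition in the definition of `A`, with `p < 2`, makes
the map to row averages bounded for `τ`. It is onto `ℓ²`, already when restricted to a sparse set
of rows, because every finitely supported `h` in a small ball can be rounded up to an element of
`B` (`exists_mem_U_avgMap_eq`); preimages are then extended from the finitely supported sequences
to all of `ℓ²`. The sets `U`, `A` and `V` are solid, so `τ` is a lattice norm, restrictions to sets
of coordinates are contractions, and the unit vectors form an unconditional basis.

The main point is that a disjoint sequence in `V` whose sup-norms tend to zero has a subsequence
whose sums of absolute values stay bounded (`exists_subseq_tau_sum_abs_le`). Three facts are used.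

* On `U` one has `ρ(u)² ≤ ‖u‖_∞` (`rho_le_sqrt_of_mem_U`), and every element of `U` has
  a majorant in `U` that dominates, at each point, all entries further to the right in the same row
  (`exists_row_majorant`).
* Let `Asmall p δ` be the set of the elements of `A` with all parts satisfying `ρ ≤ δ`. If `y ∈ V`
  has sufficiently small sup-norm, then every positive functional bounded by `1` on `Asmall p δ` is
  at most `4` at `y` (`exists_pairing_le_of_small`). Otherwise one finds disjoint sets
  `K₁, …, K_L` in `D`, each covered by boundedly many parts from `U`, on which the functional is at
  least `3/2`. Assigning each row to the set that reaches furthest to the right in it, the average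
  of the characteristic functions splits into `O(L)` row disjoint parts of `ρ`-size `O(1/L)`. Since
  `p > 1`, it lies in `Asmall p δ` for large `L`, a contradiction.
* Elements of `Asmall p (δ n)` on consecutive blocks of rows add up to an element of `2 A` provided
  that `δ n` decreases fast enough compared with the number of rows used (`half_sum_mem_A`).

Given a disjoint sequence one passes to a subsequence living on consecutive blocks of rows. A
functional norming the sum of the absolute values has, on each block, at some element of
`Asmall p (δ n)` at least a fifth of its value at the given vector, and the third fact bounds the sum.

For `c₀`-saturation, a gliding hump argument in a closed infinite dimensional subspace gives
normalized vectors close to a disjoint sequence in `G`. Either `τ` is equivalent to the sup-norm of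
the coordinates on a subspace of finite codimension, or the sequence can be taken with sup-norms
tending to zero, so that the preceding result applies.
-/

/-! ### Solidity and elementary properties of `ρ` -/

namespace Leung

/-- Pointwise multiplication of the elements of `G` by a fixed function on `D`. -/
noncomputable def mulBy (θ : D → ℝ) : G →ₗ[ℝ] G where
  toFun x := Finsupp.onFinset x.support (fun d => θ d * x d) fun d hd => by
    rw [Finsupp.mem_support_iff]
    exact right_ne_zero_of_mul hd
  map_add' x y := by ext d; simp [mul_add]
  map_smul' c x := by ext d; simp; ring

@[simp]
lemma mulBy_apply (θ : D → ℝ) (x : G) (d : D) : mulBy θ x d = θ d * x d := rfl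

/-- If `|z| ≤ |x|`, then `z` is a multiple of `x` by a function with values in `[-1, 1]`. -/
lemma exists_mulBy_eq {x z : G} (h : ∀ d, |z d| ≤ |x d|) :
    ∃ θ : D → ℝ, (∀ d, |θ d| ≤ 1) ∧ mulBy θ x = z := by
  refine ⟨fun d => z d / x d, fun d => ?_, ?_⟩
  · rw [abs_div]
    exact div_le_one_of_le₀ (h d) (abs_nonneg _)
  · ext d
    rw [mulBy_apply]
    refine div_mul_cancel_of_imp fun h0 => ?_
    have := h d
    rw [h0, abs_zero] at this
    exact abs_nonpos_iff.1 this

lemma abs_mulBy_le {θ : D → ℝ} (h : ∀ d, |θ d| ≤ 1) (x : G) (d : D) :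
    |mulBy θ x d| ≤ |x d| := by
  rw [mulBy_apply, abs_mul]
  exact mul_le_of_le_one_left (abs_nonneg _) (h d)

lemma mem_U_of_abs_le {x z : G} (hx : x ∈ U) (h : ∀ d, |z d| ≤ |x d|) : z ∈ U := by
  refine solid_U hx fun d => ?_
  rw [abs_apply, abs_apply]
  exact h d

lemma zero_mem_U : (0 : G) ∈ U :=
  mem_U_of_abs_le (single_mem_U ⟨(1, 1), le_rfl⟩) (by simp)

lemma smul_mem_U {x : G} (hx : x ∈ U) {c : ℝ} (h0 : 0 ≤ c) (h1 : c ≤ 1) : c • x ∈ U :=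
  convex_U.smul_mem_of_zero_mem zero_mem_U hx ⟨h0, h1⟩

lemma rowSum_mono {x z : G} (h : ∀ d, |z d| ≤ |x d|) (i : ℕ+) : rowSum z i ≤ rowSum x i :=
  Finset.sum_le_sum fun _ _ => h _

lemma rowSum_smul (c : ℝ) (x : G) (i : ℕ+) : rowSum (c • x) i = |c| * rowSum x i := by
  simp [rowSum, abs_mul, Finset.mul_sum]

lemma rowSum_eq_zero_iff {x : G} {i : ℕ+} : rowSum x i = 0 ↔ ∀ d : D, d.1.1 = i → x d = 0 := by
  constructor
  · rintro h d rfl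
    exact apply_eq_zero_of_rowSum h
  · intro h
    exact Finset.sum_eq_zero fun j _ => by rw [h _ rfl, abs_zero]

lemma rowSum_support_finite (x : G) : (Function.support (rowSum x)).Finite := by
  classical
  refine Set.Finite.subset (x.support.image fun d => d.1.1).finite_toSet fun i hi => ?_
  by_contra hcon
  refine hi (rowSum_eq_zero_iff.2 fun d hd => ?_)
  by_contra hne
  exact hcon (Finset.mem_coe.2 (Finset.mem_image.2 ⟨d, Finsupp.mem_support_iff.2 hne, hd⟩))

lemma summable_rho (x : G) : Summable fun i : ℕ+ => (1 / (i : ℝ) * rowSum x i) ^ 2 := by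
  refine summable_of_hasFiniteSupport ((rowSum_support_finite x).subset fun i hi => ?_)
  rw [Function.mem_support] at hi ⊢
  contrapose! hi
  simp [hi]

lemma rho_nonneg (x : G) : 0 ≤ rho x := Real.sqrt_nonneg _

/-- Bounds on `ρ` may be checked on finite sets of rows. -/
lemma rho_le_iff {x : G} {r : ℝ} (hr : 0 ≤ r) :
    rho x ≤ r ↔ ∀ I : Finset ℕ+, ∑ i ∈ I, (1 / (i : ℝ) * rowSum x i) ^ 2 ≤ r ^ 2 := by
  rw [rho, l2norm, Real.sqrt_le_left hr]
  constructor
  · exact fun h I => ((summable_rho x).sum_le_tsum I fun i _ => sq_nonneg _).trans h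
  · exact fun h => (summable_rho x).tsum_le_of_sum_le h

lemma sum_le_rho_sq (x : G) (I : Finset ℕ+) :
    ∑ i ∈ I, (1 / (i : ℝ) * rowSum x i) ^ 2 ≤ rho x ^ 2 :=
  (rho_le_iff (rho_nonneg x)).1 le_rfl I

lemma rho_mono {x z : G} (h : ∀ d, |z d| ≤ |x d|) : rho z ≤ rho x := by
  refine (rho_le_iff (rho_nonneg x)).2 fun I => le_trans ?_ (sum_le_rho_sq x I)
  refine Finset.sum_le_sum fun i _ => ?_
  have := rowSum_mono h i
  have := rowSum_nonneg z i
  gcongr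

lemma rho_smul (c : ℝ) (x : G) : rho (c • x) = |c| * rho x := by
  have : ∀ i : ℕ+, (1 / (i : ℝ) * rowSum (c • x) i) ^ 2
      = |c| ^ 2 * (1 / (i : ℝ) * rowSum x i) ^ 2 := fun i => by rw [rowSum_smul]; ring
  rw [rho, l2norm, tsum_congr this, tsum_mul_left, Real.sqrt_mul (sq_nonneg _),
    Real.sqrt_sq (abs_nonneg c), rho, l2norm]

lemma rho_zero : rho 0 = 0 := by simpa using rho_smul 0 0

lemma exists_apply_ne_zero_of_rho_pos {x : G} (h : 0 < rho x) : ∃ d, x d ≠ 0 := by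
  by_contra hcon
  push Not at hcon
  rw [show x = 0 from Finsupp.ext hcon, rho_zero] at h
  exact lt_irrefl _ h

lemma rowDisjoint_iff {x y : G} :
    RowDisjoint x y ↔ ∀ d e : D, d.1.1 = e.1.1 → x d ≠ 0 → y e = 0 := by
  constructor
  · intro h d e hde hx
    rcases mul_eq_zero.1 (h d.1.1) with h0 | h0
    · exact absurd (rowSum_eq_zero_iff.1 h0 d rfl) hx
    · exact rowSum_eq_zero_iff.1 h0 e hde.symm
  · intro h i
    by_cases hx : rowSum x i = 0
    · simp [hx]
    · rw [rowSum_eq_zero_iff] at hx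
      push Not at hx
      obtain ⟨d, hd, hne⟩ := hx
      rw [rowSum_eq_zero_iff.2 fun e he => h d e (hd.trans he.symm) hne, mul_zero]

/-! ### On `U` the seminorm `ρ` is controlled by the sup-norm -/

lemma sum_Iic_eq_sum_range (i : ℕ+) (g : ℕ → ℝ) :
    ∑ j : Set.Iic i, g (j.1 : ℕ) = ∑ k ∈ Finset.range i, g (k + 1) := by
  refine Finset.sum_bij (fun j _ => (j.1 : ℕ) - 1) ?_ ?_ ?_ ?_
  · intro j _
    have h1 : (j.1 : ℕ) ≤ i := j.2
    have h2 := j.1.pos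
    rw [Finset.mem_range]
    omega
  · intro j _ k _ h
    have h1 := j.1.pos
    have h2 := k.1.pos
    refine Subtype.ext (PNat.coe_injective ?_)
    omega
  · intro k hk
    rw [Finset.mem_range] at hk
    refine ⟨⟨⟨k + 1, k.succ_pos⟩, ?_⟩, Finset.mem_univ _, rfl⟩
    change k + 1 ≤ (i : ℕ)
    omega
  · intro j _
    have := j.1.pos
    congr 1
    omega

lemma sq_sum_range_le (a : ℕ → ℝ) {ε : ℝ} (h0 : ∀ k, 0 ≤ a k) (h1 : ∀ k, a k ≤ ε) (n : ℕ) :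
    (∑ k ∈ Finset.range n, a k) ^ 2 ≤ ε * ∑ k ∈ Finset.range n, (2 * (k : ℝ) + 1) * a k := by
  induction n with
  | zero => simp
  | succ n ih =>
    rw [Finset.sum_range_succ, Finset.sum_range_succ]
    have hT : ∑ k ∈ Finset.range n, a k ≤ n * ε := by
      simpa using Finset.sum_le_card_nsmul (Finset.range n) a ε fun k _ => h1 k
    have h3 := mul_le_mul_of_nonneg_right hT (h0 n)
    have h4 := mul_le_mul_of_nonneg_right (h1 n) (h0 n)
    nlinarith

lemma sum_range_odd_le (i n : ℕ) :
    ∑ k ∈ Finset.range i, (if k + 1 ≤ n then 2 * (k : ℝ) + 1 else 0) ≤ (n : ℝ) ^ 2 := by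
  have h : ∀ m : ℕ, ∑ k ∈ Finset.range m, (2 * (k : ℝ) + 1) = (m : ℝ) ^ 2 := by
    intro m
    induction m with
    | zero => simp
    | succ m ih => rw [Finset.sum_range_succ, ih]; push_cast; ring
  rw [← h n, ← Finset.sum_filter]
  refine Finset.sum_le_sum_of_subset_of_nonneg (fun k hk => ?_) fun k _ _ => by positivity
  rw [Finset.mem_filter] at hk
  exact Finset.mem_range.2 hk.2

/-- The weighted row sum `∑ⱼ (2j - 1) |x(i, j)|`; for `x = x_b` its value is `(i bᵢ)²`. -/
noncomputable def oddSum (x : G) (i : ℕ+) : ℝ :=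
  ∑ j : Set.Iic i, (2 * ((j.1 : ℕ) : ℝ) - 1) * |x ⟨(i, j.1), j.2⟩|

lemma odd_nonneg (j : ℕ+) : (0 : ℝ) ≤ 2 * ((j : ℕ) : ℝ) - 1 := by
  have : (1 : ℝ) ≤ (j : ℕ) := by exact_mod_cast (one_le : 1 ≤ j)
  linarith

/-- The functional `x ↦ ∑ᵢ i⁻² ∑ⱼ (2j - 1) |x(i, j)|` is at most `1` on `U`. It is a weighted
`ℓ¹`-norm, so it suffices to look at the elements `x_b`, where it takes the value `‖b‖₂²`. -/
lemma sum_oddSum_le_one {u : G} (hu : u ∈ U) (I : Finset ℕ+) :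
    ∑ i ∈ I, (1 / (i : ℝ) ^ 2) * oddSum u i ≤ 1 := by
  refine hu {x | ∑ i ∈ I, (1 / (i : ℝ) ^ 2) * oddSum x i ≤ 1} ⟨?_, ?_, ?_⟩
  · intro x hx y hy s t hs ht hst
    have key : ∀ i, oddSum (s • x + t • y) i ≤ s * oddSum x i + t * oddSum y i := by
      intro i
      simp only [oddSum, Finset.mul_sum, ← Finset.sum_add_distrib]
      refine Finset.sum_le_sum fun j _ => ?_
      have h1 : |(s • x + t • y) ⟨(i, j.1), j.2⟩|
          ≤ s * |x ⟨(i, j.1), j.2⟩| + t * |y ⟨(i, j.1), j.2⟩| := by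
        rw [Finsupp.add_apply, Finsupp.smul_apply, Finsupp.smul_apply, smul_eq_mul, smul_eq_mul]
        refine (abs_add_le _ _).trans_eq ?_
        rw [abs_mul, abs_mul, abs_of_nonneg hs, abs_of_nonneg ht]
      calc _ ≤ _ := mul_le_mul_of_nonneg_left h1 (odd_nonneg j.1)
        _ = _ := by ring
    calc ∑ i ∈ I, (1 / (i : ℝ) ^ 2) * oddSum (s • x + t • y) i
        ≤ ∑ i ∈ I, (1 / (i : ℝ) ^ 2) * (s * oddSum x i + t * oddSum y i) := by
          gcongr with i
          exact key i
      _ = s * ∑ i ∈ I, (1 / (i : ℝ) ^ 2) * oddSum x i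
          + t * ∑ i ∈ I, (1 / (i : ℝ) ^ 2) * oddSum y i := by
          simp only [Finset.mul_sum, ← Finset.sum_add_distrib]
          exact Finset.sum_congr rfl fun i _ => by ring
      _ ≤ s * 1 + t * 1 := by gcongr; exacts [hx, hy]
      _ = 1 := by linarith
  · intro x hx y hxy
    rw [Set.mem_ofPred_eq] at hx ⊢
    refine le_trans ?_ hx
    gcongr with i _
    refine Finset.sum_le_sum fun j _ => mul_le_mul_of_nonneg_left ?_ (odd_nonneg j.1)
    have := hxy ⟨(i, j.1), j.2⟩
    rwa [abs_apply, abs_apply] at this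
  · intro b hb
    have hsum : ∑ i ∈ I, b i ^ 2 ≤ 1 := by
      have hs : Summable fun i => b i ^ 2 :=
        summable_of_hasFiniteSupport (b.hasFiniteSupport.subset fun i hi => by
          rw [Function.mem_support] at hi ⊢
          contrapose! hi
          simp [hi])
      refine (hs.sum_le_tsum I fun i _ => sq_nonneg _).trans ?_
      have := hb.2
      rwa [l2norm, Real.sqrt_le_left zero_le_one, one_pow] at this
    refine le_trans (Finset.sum_le_sum fun i _ => ?_) hsum
    obtain ⟨n, hn⟩ := hb.1 i
    have hi : (0 : ℝ) < (i : ℕ) := by exact_mod_cast i.pos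
    have h1 : oddSum (xb b) i
        = ∑ k ∈ Finset.range i, (if k + 1 ≤ n then 2 * (k : ℝ) + 1 else 0) := by
      rw [oddSum]
      trans ∑ k ∈ Finset.range i,
        (fun m : ℕ => if m ≤ n then 2 * (m : ℝ) - 1 else 0) (k + 1)
      · refine Eq.trans ?_ (sum_Iic_eq_sum_range i fun m : ℕ =>
          if m ≤ n then 2 * (m : ℝ) - 1 else 0)
        refine Finset.sum_congr rfl fun j _ => ?_
        change _ * |if ((j.1 : ℕ) : ℝ) ≤ (i : ℝ) * b i then (1 : ℝ) else 0| = _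
        rw [hn]
        simp only [Nat.cast_le]
        split_ifs <;> simp
      · refine Finset.sum_congr rfl fun k _ => ?_
        dsimp only
        split_ifs
        · push_cast; ring
        · rfl
    have hb2 : b i ^ 2 = 1 / (i : ℝ) ^ 2 * (n : ℝ) ^ 2 := by
      rw [← hn]; field_simp
    rw [h1, hb2]
    gcongr
    exact sum_range_odd_le _ _

/-- If `u ∈ U` has small sup-norm, then `ρ(u)` is small. -/
lemma rho_le_sqrt_of_mem_U {u : G} (hu : u ∈ U) {ε : ℝ} (h : ∀ d, |u d| ≤ ε) :
    rho u ≤ √ε := by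
  have hε : 0 ≤ ε := (abs_nonneg _).trans (h ⟨(1, 1), le_rfl⟩)
  refine (rho_le_iff (Real.sqrt_nonneg _)).2 fun I => ?_
  rw [Real.sq_sqrt hε]
  calc ∑ i ∈ I, (1 / (i : ℝ) * rowSum u i) ^ 2
      ≤ ∑ i ∈ I, ε * ((1 / (i : ℝ) ^ 2) * oddSum u i) := by
        refine Finset.sum_le_sum fun i _ => ?_
        classical
        -- the absolute values of the entries of row `i`, indexed by `1, …, i`
        let a : ℕ → ℝ := fun m => if hm : 0 < m ∧ m ≤ i then
          |u ⟨(i, ⟨m, hm.1⟩), hm.2⟩| else 0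
        have ha0 : ∀ m, 0 ≤ a m := fun m => by
          dsimp only [a]; split_ifs
          exacts [abs_nonneg _, le_rfl]
        have ha1 : ∀ m, a m ≤ ε := fun m => by
          dsimp only [a]; split_ifs
          exacts [h _, hε]
        have haj : ∀ j : Set.Iic i, |u ⟨(i, j.1), j.2⟩| = a (j.1 : ℕ) := fun j => by
          have : 0 < (j.1 : ℕ) ∧ (j.1 : ℕ) ≤ i := ⟨j.1.pos, j.2⟩
          dsimp only [a]
          rw [dif_pos this]
          rfl
        have h1 : rowSum u i = ∑ k ∈ Finset.range i, a (k + 1) := by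
          rw [← sum_Iic_eq_sum_range i a, rowSum]
          exact Finset.sum_congr rfl fun j _ => haj j
        have h2 : oddSum u i = ∑ k ∈ Finset.range i, (2 * (k : ℝ) + 1) * a (k + 1) := by
          have := sum_Iic_eq_sum_range i fun m => (2 * (m : ℝ) - 1) * a m
          rw [oddSum, Finset.sum_congr rfl fun j _ => by rw [haj j], this]
          exact Finset.sum_congr rfl fun k _ => by push_cast; ring
        have h3 := sq_sum_range_le (fun k => a (k + 1)) (fun k => ha0 _) (fun k => ha1 _) i
        rw [mul_pow, h1, h2, div_pow, one_pow]
        calc _ ≤ 1 / (i : ℝ) ^ 2 * (ε * ∑ k ∈ Finset.range i, (2 * (k : ℝ) + 1) * a (k + 1)) := by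
              gcongr
          _ = _ := by ring
    _ = ε * ∑ i ∈ I, (1 / (i : ℝ) ^ 2) * oddSum u i := by rw [Finset.mul_sum]
    _ ≤ ε * 1 := by
        gcongr
        exact sum_oddSum_le_one hu I
    _ = ε := mul_one ε

lemma rho_le_one_of_mem_U {u : G} (hu : u ∈ U) : rho u ≤ 1 := by
  simpa using rho_le_sqrt_of_mem_U hu (abs_le_one_of_mem_U hu)

/-- Since the `x_b` decrease along the rows, every `u ∈ U` has a majorant `v ∈ U` which dominates,
at each point, also all the entries of `u` further to the right in the same row. -/
lemma exists_row_majorant {u : G} (hu : u ∈ U) :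
    ∃ v ∈ U, ∀ d e : D, d.1.1 = e.1.1 → d.1.2 ≤ e.1.2 → |u e| ≤ v d := by
  refine hu {u | ∃ v ∈ U, ∀ d e : D, d.1.1 = e.1.1 → d.1.2 ≤ e.1.2 → |u e| ≤ v d} ⟨?_, ?_, ?_⟩
  · rintro x ⟨v, hv, hxv⟩ y ⟨w, hw, hyw⟩ s t hs ht hst
    refine ⟨s • v + t • w, convex_U hv hw hs ht hst, fun d e h1 h2 => ?_⟩
    calc |(s • x + t • y) e| ≤ |s * x e| + |t * y e| := by
          simpa using abs_add_le (s * x e) (t * y e)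
      _ = s * |x e| + t * |y e| := by rw [abs_mul, abs_mul, abs_of_nonneg hs, abs_of_nonneg ht]
      _ ≤ s * v d + t * w d := by gcongr; exacts [hxv d e h1 h2, hyw d e h1 h2]
      _ = _ := by simp
  · rintro x ⟨v, hv, hxv⟩ y hxy
    refine ⟨v, hv, fun d e h1 h2 => le_trans ?_ (hxv d e h1 h2)⟩
    have := hxy e
    rwa [abs_apply, abs_apply] at this
  · intro b hb
    refine ⟨xb b, xb_mem_U hb, fun d e h1 h2 => ?_⟩
    change |if ((e.1.2 : ℕ) : ℝ) ≤ (e.1.1 : ℝ) * b e.1.1 then (1 : ℝ) else 0|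
      ≤ if ((d.1.2 : ℕ) : ℝ) ≤ (d.1.1 : ℝ) * b d.1.1 then (1 : ℝ) else 0
    rw [h1]
    have h3 : ((d.1.2 : ℕ) : ℝ) ≤ (e.1.2 : ℕ) := by exact_mod_cast h2
    split_ifs with h4 h5
    · simp
    · exact absurd (h3.trans h4) h5
    · simp
    · simp

/-! ### Row decompositions -/

open scoped Classical in
/-- The part of `x` on the rows with colour `k`, for a colouring `c` of the rows. -/
noncomputable def rowPart {ι : Type} (c : ℕ+ → ι) (k : ι) (x : G) : G :=
  x.filter fun d => c d.1.1 = k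

open scoped Classical in
lemma rowPart_apply {ι : Type} (c : ℕ+ → ι) (k : ι) (x : G) (d : D) :
    rowPart c k x d = if c d.1.1 = k then x d else 0 := Finsupp.filter_apply _ _ _

lemma abs_rowPart_le {ι : Type} (c : ℕ+ → ι) (k : ι) (x : G) (d : D) :
    |rowPart c k x d| ≤ |x d| := by
  rw [rowPart_apply]
  split_ifs
  · rfl
  · simp

lemma abs_rowPart_mono {ι : Type} (c : ℕ+ → ι) (k : ι) {x z : G} (h : ∀ d, |z d| ≤ |x d|)
    (d : D) : |rowPart c k z d| ≤ |rowPart c k x d| := by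
  rw [rowPart_apply, rowPart_apply]
  split_ifs
  · exact h d
  · rfl

/-- The colouring `c` of the rows splits `x` into elements of `U` on which `ρ` is at most `δ`,
and whose sequence of `ρ`-values lies in the unit ball of weak `ℓᵖ`. The last condition is
expressed by counting: at most `t⁻ᵖ` of the parts have `ρ ≥ t`. -/
structure IsRowDecomp (p δ : ℝ) {ι : Type} (c : ℕ+ → ι) (x : G) : Prop where
  mem_U : ∀ k, rowPart c k x ∈ U
  rho_le : ∀ k, rho (rowPart c k x) ≤ δ
  card_le : ∀ t : ℝ, 0 < t → ∀ s : Finset ι, (∀ k ∈ s, t ≤ rho (rowPart c k x)) →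
    (s.card : ℝ) * t ^ p ≤ 1

lemma IsRowDecomp.of_abs_le {p δ : ℝ} {ι : Type} {c : ℕ+ → ι} {x z : G}
    (hx : IsRowDecomp p δ c x) (h : ∀ d, |z d| ≤ |x d|) : IsRowDecomp p δ c z where
  mem_U k := mem_U_of_abs_le (hx.mem_U k) (abs_rowPart_mono c k h)
  rho_le k := (rho_mono (abs_rowPart_mono c k h)).trans (hx.rho_le k)
  card_le t ht s hs := hx.card_le t ht s fun k hk =>
    (hs k hk).trans (rho_mono (abs_rowPart_mono c k h))

/-- The elements of `A` that are built from parts with `ρ ≤ δ`. -/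
def Asmall (p δ : ℝ) : Set G := {x | ∃ (ι : Type) (c : ℕ+ → ι), IsRowDecomp p δ c x}

lemma Asmall_of_abs_le {p δ : ℝ} {x z : G} (hx : x ∈ Asmall p δ) (h : ∀ d, |z d| ≤ |x d|) :
    z ∈ Asmall p δ := by
  obtain ⟨ι, c, hc⟩ := hx
  exact ⟨ι, c, hc.of_abs_le h⟩

lemma decRearr_nonneg {m : ℕ} (a : Fin m → ℝ) (n : Fin m) : 0 ≤ decRearr a n := abs_nonneg _

/-- The weak `ℓᵖ` unit ball in terms of the distribution function. -/
lemma lorentz_le_one_iff {p : ℝ} (hp : 0 < p) {m : ℕ} (a : Fin m → ℝ) :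
    lorentz p a ≤ 1 ↔
      ∀ t : ℝ, 0 < t → ((Finset.univ.filter fun k => t ≤ |a k|).card : ℝ) * t ^ p ≤ 1 := by
  -- the `n`-th entry of the rearrangement is `≥ t` iff more than `n` entries are
  have hcount : ∀ (n : Fin m) (t : ℝ),
      (n : ℕ) < (Finset.univ.filter fun k => t ≤ |a k|).card ↔ t ≤ decRearr a n := by
    intro n t
    have h1 := Tuple.lt_card_le_iff_apply_le_of_monotone (j := n) (a := -t)
      (Tuple.monotone_sort fun k => -|a k|)
    have h2 : (Finset.univ.filter fun i =>
        ((fun k => -|a k|) ∘ Tuple.sort fun k => -|a k|) i ≤ -t).card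
        = (Finset.univ.filter fun k => t ≤ |a k|).card := by
      refine Finset.card_bij (fun i _ => Tuple.sort (fun k => -|a k|) i) ?_ ?_ ?_
      · intro i hi
        simpa using hi
      · intro i _ j _ h
        exact (Tuple.sort fun k => -|a k|).injective h
      · intro k hk
        exact ⟨(Tuple.sort fun k => -|a k|).symm k, by simpa using hk, by simp⟩
    rw [h2] at h1
    rw [h1]
    simp [decRearr]
  have hpow : ∀ (c : ℕ) (t : ℝ), 0 ≤ t → (t * (c : ℝ) ^ (1 / p) ≤ 1 ↔ (c : ℝ) * t ^ p ≤ 1) := by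
    intro c t ht
    have h0 : (0 : ℝ) ≤ t * (c : ℝ) ^ (1 / p) := by positivity
    rw [← Real.rpow_le_rpow_iff h0 zero_le_one hp, Real.one_rpow, Real.mul_rpow ht (by positivity),
      ← Real.rpow_mul (by positivity), one_div_mul_cancel hp.ne', Real.rpow_one, mul_comm]
  constructor
  · intro h t ht
    rcases Nat.eq_zero_or_pos (Finset.univ.filter fun k => t ≤ |a k|).card with h0 | h0
    · simp [h0]
    obtain ⟨n, hn⟩ : ∃ n : Fin m, (n : ℕ) + 1 = (Finset.univ.filter fun k => t ≤ |a k|).card := by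
      have : (Finset.univ.filter fun k => t ≤ |a k|).card ≤ m := by
        simpa using Finset.card_filter_le (Finset.univ : Finset (Fin m)) fun k => t ≤ |a k|
      exact ⟨⟨(Finset.univ.filter fun k => t ≤ |a k|).card - 1, by omega⟩, by simp; omega⟩
    have h1 : t ≤ decRearr a n := (hcount n t).1 (by omega)
    have h2 : decRearr a n * ((n : ℝ) + 1) ^ (1 / p) ≤ 1 :=
      (le_ciSup (f := fun n : Fin m => decRearr a n * ((n : ℝ) + 1) ^ (1 / p))
        (Set.finite_range _).bddAbove n).trans h
    rw [← hn, ← hpow _ _ ht.le]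
    push_cast
    refine le_trans ?_ h2
    gcongr
  · intro h
    refine Real.iSup_le (fun n => ?_) zero_le_one
    rcases (decRearr_nonneg a n).eq_or_lt with h0 | h0
    · simp [← h0]
    · have h1 := (hcount n _).2 le_rfl
      have h2 : (((n : ℕ) + 1 : ℕ) : ℝ) * decRearr a n ^ p ≤ 1 := by
        refine le_trans ?_ (h _ h0)
        gcongr
        exact h1
      rw [← hpow _ _ h0.le] at h2
      push_cast at h2
      exact h2

lemma zero_mem_A (p : ℝ) : (0 : G) ∈ A p := by
  refine ⟨1, fun _ => 0, one_pos, fun _ => zero_mem_U, fun k l hkl => absurd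
    (Subsingleton.elim k l) hkl, ?_, by simp⟩
  refine Real.iSup_le (fun n => ?_) zero_le_one
  simp [decRearr, rho_zero]

lemma IsRowDecomp.mem_A {p δ : ℝ} (hp : 0 < p) {ι : Type} {c : ℕ+ → ι} {x : G}
    (hx : IsRowDecomp p δ c x) : x ∈ A p := by
  classical
  set S := x.support.image fun d => c d.1.1 with hS
  let e := S.equivFin.symm
  rcases Nat.eq_zero_or_pos S.card with h0 | h0
  · have : x = 0 := by
      rw [Finset.card_eq_zero, hS, Finset.image_eq_empty] at h0
      exact Finsupp.support_eq_empty.1 h0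
    rw [this]
    exact zero_mem_A p
  refine ⟨S.card, fun k => rowPart c (e k) x, h0, fun k => hx.mem_U _, ?_, ?_, ?_⟩
  · intro k l hkl
    refine rowDisjoint_iff.2 fun d d' hdd' hne => ?_
    rw [rowPart_apply] at hne ⊢
    have h1 : c d.1.1 = e k := by
      by_contra hcon
      simp [hcon] at hne
    rw [if_neg]
    rw [← hdd', h1]
    exact fun h2 => hkl (e.injective (Subtype.ext h2))
  · rw [lorentz_le_one_iff hp]
    intro t ht
    have h1 := hx.card_le t ht
      ((Finset.univ.filter fun k => t ≤ |rho (rowPart c (e k) x)|).map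
        (e.toEmbedding.trans (Function.Embedding.subtype _))) (by
          intro k hk
          simp only [Finset.mem_map, Finset.mem_filter, Finset.mem_univ, true_and] at hk
          obtain ⟨l, hl, rfl⟩ := hk
          rwa [abs_of_nonneg (rho_nonneg _)] at hl)
    rwa [Finset.card_map] at h1
  · ext d
    rw [Finsupp.finsetSum_apply]
    simp only [rowPart_apply]
    by_cases hd : x d = 0
    · simp [hd]
    · have hdS : c d.1.1 ∈ S :=
        Finset.mem_image.2 ⟨d, Finsupp.mem_support_iff.2 hd, rfl⟩
      rw [Finset.sum_eq_single (e.symm ⟨_, hdS⟩)]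
      · simp
      · intro k _ hk
        rw [if_neg]
        intro h
        exact hk (e.injective (Subtype.ext (by simp [h])))
      · simp

lemma Asmall_subset_A {p δ : ℝ} (hp : 0 < p) : Asmall p δ ⊆ A p := by
  rintro x ⟨ι, c, hc⟩
  exact hc.mem_A hp

/-- The bound `ρ ≤ 1` for the parts is automatic. -/
lemma A_subset_Asmall_one {p : ℝ} (hp : 0 < p) : A p ⊆ Asmall p 1 := by
  classical
  rintro x ⟨m, y, -, hU, hrow, hl, rfl⟩
  rw [lorentz_le_one_iff hp] at hl
  -- a row gets the index of the only `y k` that may be non-zero on it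
  let c : ℕ+ → Option (Fin m) := fun i =>
    if h : ∃ k, rowSum (y k) i ≠ 0 then some h.choose else none
  have hc : ∀ i k, rowSum (y k) i ≠ 0 → c i = some k := by
    intro i k hk
    have h : ∃ k, rowSum (y k) i ≠ 0 := ⟨k, hk⟩
    dsimp only [c]
    rw [dif_pos h]
    by_contra hne
    have hne' : h.choose ≠ k := fun h' => hne (by rw [h'])
    rcases mul_eq_zero.1 (hrow hne' i) with h1 | h1
    · exact h.choose_spec h1
    · exact hk h1
  have hpart : ∀ k, rowPart c k (∑ l, y l) = match k with
      | none => 0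
      | some k => y k := by
    intro k
    ext d
    rw [rowPart_apply, Finsupp.finsetSum_apply]
    have hz : ∀ l, c d.1.1 ≠ some l → y l d = 0 := fun l hl => by
      by_contra hne
      exact hl (hc _ _ fun h => hne (apply_eq_zero_of_rowSum h))
    rcases k with _ | k
    · split_ifs with h
      · exact Finset.sum_eq_zero fun l _ => hz l (by simp [h])
      · rfl
    · split_ifs with h
      · refine Finset.sum_eq_single k (fun l _ hl => hz l ?_) (by simp)
        rw [h]
        simpa using hl.symm
      · exact (hz k h).symm
  refine ⟨Option (Fin m), c, ?_, ?_, ?_⟩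
  · rintro (_ | k) <;> rw [hpart]
    exacts [zero_mem_U, hU k]
  · rintro (_ | k) <;> rw [hpart]
    exacts [by simp [rho_zero], rho_le_one_of_mem_U (hU k)]
  · intro t ht s hs
    refine le_trans ?_ (hl t ht)
    gcongr
    have hsub : s ⊆ (Finset.univ.filter fun k => t ≤ |rho (y k)|).map
        Function.Embedding.some := by
      rintro (_ | k) hk
      · have := hs _ hk
        rw [hpart] at this
        simp only [rho_zero] at this
        exact absurd this (not_le.2 ht)
      · have := hs _ hk
        rw [hpart] at this
        simp only [Finset.mem_map, Finset.mem_filter, Finset.mem_univ, true_and]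
        exact ⟨k, this.trans (le_abs_self _), rfl⟩
    simpa using Finset.card_le_card hsub

lemma mem_A_of_abs_le {p : ℝ} (hp : 0 < p) {x z : G} (hx : x ∈ A p) (h : ∀ d, |z d| ≤ |x d|) :
    z ∈ A p :=
  Asmall_subset_A hp (Asmall_of_abs_le (A_subset_Asmall_one hp hx) h)

lemma U_subset_A {p : ℝ} : U ⊆ A p := by
  intro u hu
  refine ⟨1, fun _ => u, one_pos, fun _ => hu, fun k l hkl => absurd
    (Subsingleton.elim k l) hkl, ?_, by simp⟩
  refine Real.iSup_le (fun n => ?_) zero_le_one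
  have hn : (n : ℕ) = 0 := by omega
  simpa [decRearr, hn, abs_of_nonneg (rho_nonneg u)] using rho_le_one_of_mem_U hu

/-! ### The lattice norm `τ` -/

lemma mem_V_of_abs_le {p : ℝ} (hp : 0 < p) {x z : G} (hx : x ∈ V p) (h : ∀ d, |z d| ≤ |x d|) :
    z ∈ V p := by
  obtain ⟨θ, hθ, rfl⟩ := exists_mulBy_eq h
  have hsub : V p ⊆ mulBy θ ⁻¹' V p :=
    convexHull_min
      (fun y hy => subset_convexHull ℝ _ (mem_A_of_abs_le hp hy (abs_mulBy_le hθ y)))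
      ((convex_convexHull ℝ _).linear_preimage (mulBy θ))
  exact hsub hx

lemma tau_nonneg (p : ℝ) (x : G) : 0 ≤ tau p x := gauge_nonneg _

lemma mem_V_of_tau_lt_one {p : ℝ} {x : G} (h : tau p x < 1) : x ∈ V p :=
  setOfPred_gauge_lt_one_subset_self (convex_convexHull ℝ _) (zero_mem_V p) (absorbent_V p) h

lemma tau_le_one_of_mem_V {p : ℝ} {x : G} (h : x ∈ V p) : tau p x ≤ 1 := gauge_le_one_of_mem h

lemma tau_smul (p c : ℝ) (x : G) : tau p (c • x) = |c| * tau p x := (tau_core p).norm_smul c x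

/-- A homogeneous bound for `τ` may be checked on the unit ball. -/
lemma le_mul_tau_of_forall_mem_V {p C : ℝ} {q : G → ℝ}
    (hq : ∀ (c : ℝ) (x : G), 0 ≤ c → q (c • x) = c * q x) (h : ∀ x ∈ V p, q x ≤ C) (x : G) :
    q x ≤ C * tau p x := by
  have hC : 0 ≤ C := by
    have h0 := h 0 (zero_mem_V p)
    have h1 := hq 0 0 le_rfl
    rw [zero_smul, zero_mul] at h1
    rwa [h1] at h0
  refine le_of_forall_pos_le_add fun ε hε => ?_
  set s := tau p x + ε / (C + 1) with hs
  have hspos : 0 < s := by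
    have := tau_nonneg p x
    positivity
  have hmem : s⁻¹ • x ∈ V p := by
    refine mem_V_of_tau_lt_one ?_
    rw [tau_smul, abs_of_pos (inv_pos.2 hspos), inv_mul_lt_one₀ hspos, hs]
    have : 0 < ε / (C + 1) := by positivity
    linarith
  have h1 := h _ hmem
  rw [hq _ _ (inv_pos.2 hspos).le, inv_mul_le_iff₀ hspos] at h1
  have h2 : C * (ε / (C + 1)) ≤ ε := by
    rw [mul_div_assoc', div_le_iff₀ (by linarith)]
    nlinarith
  calc q x ≤ s * C := h1
    _ = C * tau p x + C * (ε / (C + 1)) := by rw [hs]; ring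
    _ ≤ _ := by linarith

lemma tau_mono {p : ℝ} (hp : 0 < p) {x z : G} (h : ∀ d, |z d| ≤ |x d|) : tau p z ≤ tau p x := by
  obtain ⟨θ, hθ, rfl⟩ := exists_mulBy_eq h
  have := le_mul_tau_of_forall_mem_V (p := p) (C := 1) (q := fun x => tau p (mulBy θ x))
    (fun c x hc => by rw [map_smul, tau_smul, abs_of_nonneg hc])
    (fun x hx => tau_le_one_of_mem_V (mem_V_of_abs_le hp hx (abs_mulBy_le hθ x))) x
  simpa using this

/-! ### Elements of `V` with small sup-norm -/

/-- The linear functional on `G` with coefficients `f`. -/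
noncomputable def pairing (f : D → ℝ) : G →ₗ[ℝ] ℝ := Finsupp.linearCombination ℝ f

lemma pairing_eq_sum (f : D → ℝ) {x : G} {S : Finset D} (h : x.support ⊆ S) :
    pairing f x = ∑ d ∈ S, f d * x d := by
  rw [pairing, Finsupp.linearCombination_apply, Finsupp.sum_of_support_subset x h]
  · exact Finset.sum_congr rfl fun d _ => by rw [smul_eq_mul, mul_comm]
  · simp

lemma pairing_mono {f : D → ℝ} (hf : ∀ d, 0 ≤ f d) {x z : G} (h : ∀ d, x d ≤ z d) :
    pairing f x ≤ pairing f z := by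
  classical
  rw [pairing_eq_sum f (Finset.subset_union_left (s₂ := z.support)),
    pairing_eq_sum f (Finset.subset_union_right (s₁ := x.support))]
  exact Finset.sum_le_sum fun d _ => mul_le_mul_of_nonneg_left (h d) (hf d)

lemma pairing_mul (f θ : D → ℝ) (x : G) :
    pairing (fun d => f d * θ d) x = pairing f (mulBy θ x) := by
  rw [pairing_eq_sum _ (Finset.Subset.refl x.support),
    pairing_eq_sum f (S := x.support) fun d hd => ?_]
  · exact Finset.sum_congr rfl fun d _ => by rw [mulBy_apply, mul_assoc]
  · rw [Finsupp.mem_support_iff, mulBy_apply] at hd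
    exact Finsupp.mem_support_iff.2 (right_ne_zero_of_mul hd)

/-- The characteristic function of a finite subset of `D`. -/
noncomputable def ind (W : Finset D) : G := Finsupp.indicator W fun _ _ => 1

open scoped Classical in
lemma ind_apply (W : Finset D) (d : D) : ind W d = if d ∈ W then 1 else 0 := by
  rw [ind, Finsupp.indicator_apply]
  simp

lemma pairing_ind (f : D → ℝ) (W : Finset D) : pairing f (ind W) = ∑ d ∈ W, f d := by
  classical
  rw [pairing_eq_sum f (S := W) fun d hd => ?_]
  · exact Finset.sum_congr rfl fun d hd => by simp [ind_apply, hd]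
  · rw [Finsupp.mem_support_iff, ind_apply] at hd
    by_contra h
    simp [h] at hd

/-- The rows can be coloured with `N` colours in such a way that, for each colour, the left hull
of the part of `W` on the rows of this colour has a characteristic function in `γ⁻¹ U`. Here the
left hull of a set contains with a point all the points to its left in the same row. -/
def FillColorable (γ : ℝ) (N : ℕ) (W : Finset D) : Prop :=
  ∃ c : ℕ+ → Fin N, ∀ k, ∃ u ∈ U, ∀ e ∈ W, c e.1.1 = k →
    ∀ d : D, d.1.1 = e.1.1 → d.1.2 ≤ e.1.2 → γ ≤ u d

/-- The number of colours is additive under unions, since the left hull of a union is, row by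
row, one of the two left hulls. -/
lemma FillColorable.union [DecidableEq D] {γ : ℝ} {N₁ N₂ : ℕ} {W₁ W₂ : Finset D}
    (h₁ : FillColorable γ N₁ W₁) (h₂ : FillColorable γ N₂ W₂) :
    FillColorable γ (N₁ + N₂) (W₁ ∪ W₂) := by
  classical
  obtain ⟨c₁, hc₁⟩ := h₁
  obtain ⟨c₂, hc₂⟩ := h₂
  -- the rows in which `W₁` reaches at least as far to the right as `W₂`
  let P : ℕ+ → Prop := fun i =>
    ∃ e ∈ W₁, e.1.1 = i ∧ ∀ e' ∈ W₂, e'.1.1 = i → e'.1.2 ≤ e.1.2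
  refine ⟨fun i => finSumFinEquiv (if P i then Sum.inl (c₁ i) else Sum.inr (c₂ i)), fun k => ?_⟩
  obtain ⟨k, rfl⟩ := finSumFinEquiv.surjective k
  simp only [EmbeddingLike.apply_eq_iff_eq]
  rcases k with k | k
  · obtain ⟨u, hu, hW⟩ := hc₁ k
    refine ⟨u, hu, fun e he hk d hd hde => ?_⟩
    split_ifs at hk with hP
    obtain ⟨e₀, he₀, hrow, hmax⟩ := hP
    have hk' : c₁ e.1.1 = k := Sum.inl_injective hk
    rcases Finset.mem_union.1 he with he1 | he2
    · exact hW e he1 hk' d hd hde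
    · exact hW e₀ he₀ (by rw [hrow, hk']) d (hd.trans hrow.symm) (hde.trans (hmax e he2 rfl))
  · obtain ⟨u, hu, hW⟩ := hc₂ k
    refine ⟨u, hu, fun e he hk d hd hde => ?_⟩
    split_ifs at hk with hP
    have hk' : c₂ e.1.1 = k := Sum.inr_injective hk
    rcases Finset.mem_union.1 he with he1 | he2
    · have : ¬ ∀ e' ∈ W₂, e'.1.1 = e.1.1 → e'.1.2 ≤ e.1.2 := fun h => hP ⟨e, he1, rfl, h⟩
      push Not at this
      obtain ⟨e', he', hrow, hlt⟩ := this
      exact hW e' he' (by rw [hrow, hk']) d (hd.trans hrow.symm) (hde.trans hlt.le)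
    · exact hW e he2 hk' d hd hde

lemma FillColorable.smul_ind_mem_Asmall {p δ γ s : ℝ} (hp : 0 < p) {N : ℕ} {W : Finset D}
    (h : FillColorable γ N W) (hγ : 0 < γ) (hs : 0 < s) (hsγ : s ≤ γ) (hδ : s / γ ≤ δ)
    (hN : (N : ℝ) * (s / γ) ^ p ≤ 1) : s • ind W ∈ Asmall p δ := by
  classical
  obtain ⟨c, hc⟩ := h
  choose u hu hW using hc
  have hle : ∀ k d, |rowPart c k (s • ind W) d| ≤ |((s / γ) • u k) d| := by
    intro k d
    rw [rowPart_apply, Finsupp.smul_apply, Finsupp.smul_apply, ind_apply]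
    by_cases hk : c d.1.1 = k
    · by_cases hd : d ∈ W
      · have h1 := hW k d hd hk d rfl le_rfl
        rw [if_pos hk, if_pos hd, smul_eq_mul, mul_one, smul_eq_mul, abs_of_pos hs,
          abs_of_nonneg (by have := hγ.le.trans h1; positivity), div_mul_eq_mul_div,
          le_div_iff₀ hγ]
        gcongr
      · simpa [hd] using mul_nonneg (abs_nonneg _) (abs_nonneg _)
    · simpa [hk] using mul_nonneg (abs_nonneg _) (abs_nonneg _)
  have hsγ0 : 0 < s / γ := div_pos hs hγ
  have hρ : ∀ k, rho (rowPart c k (s • ind W)) ≤ s / γ := fun k => by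
    refine (rho_mono (hle k)).trans ?_
    rw [rho_smul, abs_of_pos hsγ0]
    exact mul_le_of_le_one_right hsγ0.le (rho_le_one_of_mem_U (hu k))
  refine ⟨Fin N, c, fun k => ?_, fun k => (hρ k).trans hδ, fun t ht S hS => ?_⟩
  · exact mem_U_of_abs_le (smul_mem_U (hu k) hsγ0.le ((div_le_one hγ).2 hsγ)) (hle k)
  · rcases S.eq_empty_or_nonempty with rfl | ⟨k, hk⟩
    · simp
    · have h1 : t ≤ s / γ := (hS k hk).trans (hρ k)
      have h2 : S.card ≤ N := by simpa using Finset.card_le_univ S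
      refine le_trans ?_ hN
      gcongr

/-- If a positive functional `f` is bounded by `1` on `Asmall p δ`, its large values on `A` come
from large entries in the parts with `ρ > δ`, whose number is at most `M`. -/
lemma exists_fillColorable_of_lt_pairing {p δ : ℝ} (hp : 0 < p) (hδ : 0 < δ) (hδ1 : δ ≤ 1)
    {M : ℕ} (hM : 1 ≤ M * δ ^ p) {f : D → ℝ} (hf : ∀ d, 0 ≤ f d)
    (hA : ∀ x ∈ Asmall p δ, pairing f x ≤ 1) {x : G} (hx : x ∈ A p) (hx0 : ∀ d, 0 ≤ x d)
    (hfx : 7 / 2 < pairing f x) :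
    ∃ K ⊆ x.support, 3 / 2 ≤ ∑ d ∈ K, f d ∧ ∑ d ∈ K, f d ≤ 1 / δ ^ 3 ∧
      FillColorable (δ ^ 2) M K := by
  classical
  have hx1 : ∀ d, x d ≤ 1 := fun d => (le_abs_self _).trans (abs_le_one_of_mem_A hx d)
  obtain ⟨ι, c, hc⟩ := A_subset_Asmall_one hp hx
  let head : ι → Prop := fun k => δ < rho (rowPart c k x)
  let tail : G := mulBy (fun d => if head (c d.1.1) then 0 else 1) x
  let low : G := mulBy (fun d => if x d ≤ δ ^ 2 then 1 else 0) x
  let K : Finset D := x.support.filter fun d => head (c d.1.1) ∧ δ ^ 2 < x d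
  -- the parts of `x` with `ρ ≤ δ`
  have htail : pairing f tail ≤ 1 := by
    have hle : ∀ d, |tail d| ≤ |x d| :=
      abs_mulBy_le (fun d => by split_ifs <;> simp) x
    refine hA _ ⟨ι, c, (hc.of_abs_le hle).mem_U, fun k => ?_, (hc.of_abs_le hle).card_le⟩
    by_cases hk : head k
    · have : rho (rowPart c k tail) ≤ rho 0 := rho_mono fun d => by
        rw [rowPart_apply]
        by_cases hd : c d.1.1 = k
        · simp [hd, tail, hk]
        · simp [hd]
      rw [rho_zero] at this
      exact this.trans hδ.le
    · exact (rho_mono (abs_rowPart_mono c k hle)).trans (not_lt.1 hk)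
  -- the entries of `x` that are at most `δ²`: all their parts have `ρ ≤ √(δ²)`
  have hlow : pairing f low ≤ 1 := by
    have hle : ∀ d, |low d| ≤ |x d| :=
      abs_mulBy_le (fun d => by split_ifs <;> simp) x
    have hd := hc.of_abs_le hle
    refine hA _ ⟨ι, c, hd.mem_U, fun k => ?_, hd.card_le⟩
    rw [← Real.sqrt_sq hδ.le]
    refine rho_le_sqrt_of_mem_U (hd.mem_U k) fun d => (abs_rowPart_le c k low d).trans ?_
    simp only [low, mulBy_apply]
    split_ifs with h
    · rwa [one_mul, abs_of_nonneg (hx0 d)]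
    · simp only [zero_mul, abs_zero]
      positivity
  have hsplit : pairing f x ≤ pairing f (tail + low + ind K) := by
    refine pairing_mono hf fun d => ?_
    have h0 := hx0 d
    have h1 := hx1 d
    rw [Finsupp.add_apply, Finsupp.add_apply, ind_apply]
    simp only [tail, low, mulBy_apply, K, Finset.mem_filter, Finsupp.mem_support_iff]
    by_cases hh : head (c d.1.1)
    · by_cases hl : x d ≤ δ ^ 2
      · have := not_lt.2 hl
        simp [hh, hl, this]
      · have hl' := not_le.1 hl
        have : x d ≠ 0 := by
          have : 0 < x d := lt_trans (by positivity) hl'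
          exact this.ne'
        simp [hh, hl, hl', this, h1]
    · simp only [hh, if_false, false_and, and_false, one_mul, add_zero, le_add_iff_nonneg_right]
      split_ifs <;> simp [h0]
  rw [map_add, map_add, pairing_ind] at hsplit
  refine ⟨K, Finset.filter_subset _ _, by linarith, ?_, ?_⟩
  · -- `δ x` belongs to `Asmall p δ`, and `δ² 1_K ≤ x`
    have h1 : pairing f (δ • x) ≤ 1 := by
      have hle : ∀ d, |(δ • x) d| ≤ |x d| := fun d => by
        rw [Finsupp.smul_apply, smul_eq_mul, abs_mul, abs_of_pos hδ]
        exact mul_le_of_le_one_left (abs_nonneg _) hδ1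
      have hd := hc.of_abs_le hle
      refine hA _ ⟨ι, c, hd.mem_U, fun k => ?_, hd.card_le⟩
      have : rowPart c k (δ • x) = δ • rowPart c k x := Finsupp.filter_smul
      rw [this, rho_smul, abs_of_pos hδ]
      exact mul_le_of_le_one_right hδ.le (hc.rho_le k)
    have h2 : pairing f (δ ^ 2 • ind K) ≤ pairing f x := by
      refine pairing_mono hf fun d => ?_
      rw [Finsupp.smul_apply, ind_apply]
      by_cases hd : d ∈ K
      · have := (Finset.mem_filter.1 hd).2.2
        simp [hd, this.le]
      · simp [hd, hx0 d]
    rw [map_smul, smul_eq_mul] at h1 h2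
    rw [pairing_ind] at h2
    rw [le_div_iff₀ (by positivity)]
    nlinarith
  · -- the colours of the parts with `ρ > δ` are renumbered by `Fin M`
    let H : Finset ι := (x.support.image fun d => c d.1.1).filter head
    have hH : H.card ≤ M := by
      have h1 := hc.card_le δ hδ H fun k hk => (Finset.mem_filter.1 hk).2.le
      have h2 : (0 : ℝ) < δ ^ p := by positivity
      have h3 : (H.card : ℝ) ≤ M := le_of_mul_le_mul_right (h1.trans hM) h2
      exact_mod_cast h3
    have hM0 : 0 < M := by
      rcases Nat.eq_zero_or_pos M with rfl | h
      · norm_num at hM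
      · exact h
    let g : ι → Fin M := fun k =>
      if hk : k ∈ H then Fin.castLE hH (H.equivFin ⟨k, hk⟩) else ⟨0, hM0⟩
    have hg : ∀ k ∈ H, ∀ l ∈ H, g k = g l → k = l := by
      intro k hk l hl hkl
      simp only [g, hk, hl, dif_pos] at hkl
      have := H.equivFin.injective (Fin.castLE_injective hH hkl)
      exact congrArg Subtype.val this
    have hKH : ∀ e ∈ K, c e.1.1 ∈ H := fun e he =>
      Finset.mem_filter.2 ⟨Finset.mem_image.2 ⟨e, (Finset.mem_filter.1 he).1, rfl⟩,
        (Finset.mem_filter.1 he).2.1⟩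
    refine ⟨fun i => g (c i), fun k' => ?_⟩
    by_cases hk' : ∃ k ∈ H, g k = k'
    · obtain ⟨k, hk, rfl⟩ := hk'
      obtain ⟨v, hv, hmaj⟩ := exists_row_majorant (hc.mem_U k)
      refine ⟨v, hv, fun e he hek d hd hde => le_trans ?_ (hmaj d e hd hde)⟩
      rw [rowPart_apply, if_pos (hg _ (hKH e he) _ hk hek), abs_of_nonneg (hx0 e)]
      exact (Finset.mem_filter.1 he).2.2.le
    · exact ⟨0, zero_mem_U, fun e he hek => absurd ⟨_, hKH e he, hek⟩ hk'⟩

/-- The number of sets needed in the disjointification argument. This is where `p > 1` enters. -/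
lemma exists_large_number {p : ℝ} (hp : 1 < p) {δ : ℝ} (hδ : 0 < δ) (M : ℕ) :
    ∃ L : ℕ, 0 < L ∧ 1 / L ≤ δ ^ 3 ∧
      (((L * M + 1 : ℕ) : ℝ)) * ((1 / (L : ℝ)) / δ ^ 2) ^ p ≤ 1 := by
  have h1 : Tendsto (fun L : ℕ => (L : ℝ) ^ (p - 1)) atTop atTop :=
    (tendsto_rpow_atTop (by linarith)).comp tendsto_natCast_atTop_atTop
  have h2 : Tendsto (fun L : ℕ => 1 / (L : ℝ)) atTop (𝓝 0) := tendsto_one_div_atTop_nhds_zero_nat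
  obtain ⟨L, hL1, hL2, hL0⟩ := ((h1.eventually_ge_atTop ((M + 1) / (δ ^ 2) ^ p)).and
    ((h2.eventually_le_const (show (0 : ℝ) < δ ^ 3 by positivity)).and
      (eventually_gt_atTop 0))).exists
  refine ⟨L, hL0, hL2, ?_⟩
  have hL : (0 : ℝ) < L := by exact_mod_cast hL0
  have hLp : (0 : ℝ) < (L : ℝ) ^ p := by positivity
  have hdp : (0 : ℝ) < (δ ^ 2) ^ p := by positivity
  rw [Real.rpow_sub hL, Real.rpow_one, div_le_div_iff₀ hdp hL] at hL1
  rw [Real.div_rpow (by positivity) (by positivity), Real.div_rpow zero_le_one hL.le,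
    Real.one_rpow, div_div, mul_one_div, div_le_one (by positivity)]
  have h3 : (1 : ℝ) ≤ L := by exact_mod_cast hL0
  push_cast
  nlinarith

/-- The elements of `V` with small sup-norm belong, up to the factor `4`, to the closed convex hull
of `Asmall p δ`; this is stated for positive functionals.

If `f ≤ 1` on `Asmall p δ` but `f(y) > 4`, then one finds one after the other disjoint sets
`K₁, …, K_L`, each consisting of large entries of an element of `A` in at most `M` parts, with
`f(1_{K_s}) ≥ 3/2`. The average of their characteristic functions splits into few parts: each row
is assigned to the set `K_s` that reaches furthest to the right. -/
lemma exists_pairing_le_of_small {p : ℝ} (hp : 1 < p) {δ : ℝ} (hδ : 0 < δ) (hδ1 : δ ≤ 1) :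
    ∃ ε : ℝ, 0 < ε ∧ ∀ f : D → ℝ, (∀ d, 0 ≤ f d) → (∀ x ∈ Asmall p δ, pairing f x ≤ 1) →
      ∀ y ∈ V p, (∀ d, |y d| ≤ ε) → pairing f y ≤ 4 := by
  classical
  have hp0 : 0 < p := by linarith
  obtain ⟨M, hM⟩ := exists_nat_ge (1 / δ ^ p)
  rw [div_le_iff₀ (by positivity)] at hM
  obtain ⟨L, hL0, hL1, hL2⟩ := exists_large_number hp hδ M
  have hL : (0 : ℝ) < L := by exact_mod_cast hL0
  refine ⟨δ ^ 3 / (2 * L), by positivity, fun f hf hA y hy hyε => ?_⟩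
  by_contra! hcon
  -- the union of `n` successively chosen sets; the extra colour allows for `n = 0`
  have key : ∀ n : ℕ, n ≤ L → ∃ W : Finset D, 3 / 2 * (n : ℝ) ≤ ∑ d ∈ W, f d ∧
      ∑ d ∈ W, f d ≤ n / δ ^ 3 ∧ FillColorable (δ ^ 2) (n * M + 1) W := by
    intro n
    induction n with
    | zero =>
      exact fun _ => ⟨∅, by simp, by simp, fun _ => 0, fun _ => ⟨0, zero_mem_U, by simp⟩⟩
    | succ n ih =>
      intro hn
      obtain ⟨W, hW1, hW2, hW3⟩ := ih (by omega)
      let θ : D → ℝ := fun d => if d ∈ W then 0 else 1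
      have hθ0 : ∀ d, 0 ≤ θ d := fun d => by dsimp only [θ]; split_ifs <;> simp
      have hθ1 : ∀ d, |θ d| ≤ 1 := fun d => by dsimp only [θ]; split_ifs <;> simp
      -- deleting `W` costs little since `y` is small compared with `f(1_W)`
      have h1 : 7 / 2 < pairing f (mulBy θ y) := by
        have h2 : pairing f y ≤ pairing f (mulBy θ y + (δ ^ 3 / (2 * L)) • ind W) := by
          refine pairing_mono hf fun d => ?_
          rw [Finsupp.add_apply, mulBy_apply, Finsupp.smul_apply, ind_apply]
          dsimp only [θ]
          split_ifs
          · simpa using (le_abs_self _).trans (hyε d)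
          · simp
        rw [map_add, map_smul, pairing_ind, smul_eq_mul] at h2
        have h3 : δ ^ 3 / (2 * L) * ∑ d ∈ W, f d ≤ 1 / 2 := by
          have hnL : (n : ℝ) ≤ L := by exact_mod_cast (by omega : n ≤ L)
          calc δ ^ 3 / (2 * L) * ∑ d ∈ W, f d ≤ δ ^ 3 / (2 * L) * (L / δ ^ 3) := by
                gcongr
                exact hW2.trans (by gcongr)
            _ = 1 / 2 := by field_simp
        linarith
      obtain ⟨x, hx, hfx⟩ : ∃ x ∈ A p, 7 / 2 < pairing f (mulBy θ x) := by
        by_contra! hall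
        have hsub : V p ⊆ {x | (pairing f ∘ₗ mulBy θ) x ≤ 7 / 2} :=
          convexHull_min hall (convex_halfSpace_le (pairing f ∘ₗ mulBy θ).isLinear _)
        exact absurd (hsub hy) (not_le.2 h1)
      have hx'A : mulBy θ |x| ∈ A p := mem_A_of_abs_le hp0 hx fun d =>
        (abs_mulBy_le hθ1 _ d).trans_eq (by rw [abs_apply, abs_abs])
      obtain ⟨K, hKx, hK1, hK2, hK3⟩ := exists_fillColorable_of_lt_pairing hp0 hδ hδ1 hM hf hA
        hx'A (fun d => by
          rw [mulBy_apply, abs_apply]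
          exact mul_nonneg (hθ0 d) (abs_nonneg _))
        (hfx.trans_le (pairing_mono hf fun d => by
          rw [mulBy_apply, mulBy_apply, abs_apply]
          exact mul_le_mul_of_nonneg_left (le_abs_self _) (hθ0 d)))
      have hdisj : Disjoint W K := by
        refine Finset.disjoint_left.2 fun d hdW hdK => ?_
        have := Finsupp.mem_support_iff.1 (hKx hdK)
        simp [mulBy_apply, θ, hdW] at this
      refine ⟨W ∪ K, ?_, ?_, ?_⟩
      · rw [Finset.sum_union hdisj]
        push_cast
        linarith
      · rw [Finset.sum_union hdisj]
        push_cast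
        rw [add_div]
        linarith
      · convert hW3.union hK3 using 1
        ring
  obtain ⟨W, hW1, -, hW3⟩ := key L le_rfl
  have hmem : (1 / (L : ℝ)) • ind W ∈ Asmall p δ := by
    refine hW3.smul_ind_mem_Asmall hp0 (by positivity) (by positivity) (hL1.trans ?_) ?_ hL2
    · exact pow_le_pow_of_le_one hδ.le hδ1 (by norm_num)
    · rw [div_le_iff₀ (by positivity)]
      exact hL1.trans_eq (by ring)
  have h1 := hA _ hmem
  rw [map_smul, pairing_ind, smul_eq_mul, one_div, inv_mul_le_iff₀ hL] at h1
  linarith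

/-! ### Disjoint sequences with sup-norms tending to zero -/

/-- Elements of `Asmall p (δ n)` on consecutive blocks of rows can be added up if each `δ n` is
small compared with the number of rows used before: the parts with `ρ ≥ t` that come from a block
preceding the last relevant one are at most as many as the rows of these blocks. -/
lemma half_sum_mem_A {p : ℝ} (hp : 1 ≤ p) {x : ℕ → G} {δ : ℕ → ℝ} {r : ℕ → ℕ}
    (hx : ∀ n, x n ∈ Asmall p (δ n)) (hle : ∀ n d, x n d ≠ 0 → (d.1.1 : ℕ) ≤ r n)
    (hlt : ∀ m n, m < n → ∀ d, x n d ≠ 0 → r m < (d.1.1 : ℕ)) (hr : Monotone r)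
    (hδ : ∀ m n, m < n → (r m : ℝ) * δ n ^ p ≤ 1) (S : Finset ℕ) :
    (1 / 2 : ℝ) • ∑ n ∈ S, x n ∈ A p := by
  classical
  have hp0 : 0 < p := by linarith
  choose ι c hc using hx
  have huniq : ∀ m n (d e : D), d.1.1 = e.1.1 → x m d ≠ 0 → x n e ≠ 0 → m = n := by
    intro m n d e hde hm hn
    rcases lt_trichotomy m n with h | h | h
    · have h1 := hlt m n h e hn
      have h2 := hle m d hm
      rw [hde] at h2
      omega
    · exact h
    · have h1 := hlt n m h d hm
      have h2 := hle n e hn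
      rw [hde] at h1
      omega
  -- the index of the block that contains the row `i`
  let own : ℕ+ → ℕ := fun i =>
    if h : ∃ n ∈ S, ∃ d : D, d.1.1 = i ∧ x n d ≠ 0 then h.choose else 0
  have hown : ∀ n ∈ S, ∀ d, x n d ≠ 0 → n = own d.1.1 := by
    intro n hn d hd
    have h : ∃ n ∈ S, ∃ e : D, e.1.1 = d.1.1 ∧ x n e ≠ 0 := ⟨n, hn, d, rfl, hd⟩
    dsimp only [own]
    rw [dif_pos h]
    obtain ⟨-, e, he, hne⟩ := h.choose_spec
    exact huniq _ _ d e he.symm hd hne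
  let col : ℕ+ → Σ n, ι n := fun i => ⟨own i, c (own i) i⟩
  set X : G := (1 / 2 : ℝ) • ∑ n ∈ S, x n with hX
  have hpart : ∀ k d, |rowPart col k X d| ≤ |((1 / 2 : ℝ) • rowPart (c k.1) k.2 (x k.1)) d| := by
    intro k d
    rw [rowPart_apply]
    by_cases hk : col d.1.1 = k
    · subst hk
      have h1 : rowPart (c (own d.1.1)) (c (own d.1.1) d.1.1) (x (own d.1.1)) d
          = x (own d.1.1) d := by rw [rowPart_apply, if_pos rfl]
      rw [if_pos rfl]
      change |X d| ≤
        |(1 / 2 : ℝ) * rowPart (c (own d.1.1)) (c (own d.1.1) d.1.1) (x (own d.1.1)) d|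
      rw [h1, hX, Finsupp.smul_apply, Finsupp.finsetSum_apply, smul_eq_mul, abs_mul, abs_mul]
      refine mul_le_mul_of_nonneg_left ?_ (abs_nonneg _)
      by_cases hS : own d.1.1 ∈ S
      · rw [Finset.sum_eq_single_of_mem _ hS]
        intro n hn hne
        by_contra h
        exact hne (hown n hn d h)
      · rw [Finset.sum_eq_zero fun n hn => ?_]
        · rw [abs_zero]
          exact abs_nonneg _
        · by_contra h
          rw [← hown n hn d h] at hS
          exact hS hn
    · rw [if_neg hk, abs_zero]
      exact abs_nonneg _
  have hρ : ∀ k, rho (rowPart col k X) ≤ 1 / 2 * rho (rowPart (c k.1) k.2 (x k.1)) := by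
    intro k
    refine (rho_mono (hpart k)).trans_eq ?_
    rw [rho_smul, abs_of_pos (by norm_num)]
  have hU : ∀ k, rowPart col k X ∈ U := fun k =>
    mem_U_of_abs_le (smul_mem_U ((hc k.1).mem_U k.2) (by norm_num) (by norm_num)) (hpart k)
  refine IsRowDecomp.mem_A (δ := 1) hp0
    ⟨hU, fun k => rho_le_one_of_mem_U (hU k), fun t ht s hs => ?_⟩
  rcases s.eq_empty_or_nonempty with rfl | hne
  · simp
  obtain ⟨k₀, hk₀, hmax⟩ := s.exists_max_image (fun k => k.1) hne
  have h2t : ∀ k ∈ s, 2 * t ≤ rho (rowPart (c k.1) k.2 (x k.1)) := fun k hk => by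
    have h1 := hs k hk
    have h2 := hρ k
    linarith
  have h2t0 : 0 < 2 * t := by linarith
  -- the parts in the last block `k₀.1`
  have hlast : ((s.filter fun k => k.1 = k₀.1).card : ℝ) * (2 * t) ^ p ≤ 1 := by
    let s' : Finset (ι k₀.1) := s.preimage (Sigma.mk k₀.1) sigma_mk_injective.injOn
    have h1 := (hc k₀.1).card_le (2 * t) h2t0 s' fun k hk =>
      h2t ⟨k₀.1, k⟩ (Finset.mem_preimage.1 hk)
    have h2 : (s.filter fun k => k.1 = k₀.1) ⊆ s'.image (Sigma.mk k₀.1) := by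
      rintro ⟨n, k⟩ hk
      obtain ⟨hks, rfl⟩ := Finset.mem_filter.1 hk
      exact Finset.mem_image.2 ⟨k, Finset.mem_preimage.2 hks, rfl⟩
    refine le_trans ?_ h1
    gcongr
    exact (Finset.card_le_card h2).trans Finset.card_image_le
  -- the parts in earlier blocks are non-zero on distinct rows `≤ r (k₀.1 - 1)`, and `2t ≤ δ k₀.1`
  have hfirst : ((s.filter fun k => ¬ k.1 = k₀.1).card : ℝ) * (2 * t) ^ p ≤ 1 := by
    rcases (s.filter fun k => ¬ k.1 = k₀.1).eq_empty_or_nonempty with h0 | ⟨k₁, hk₁⟩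
    · simp [h0]
    have hlt₀ : ∀ k ∈ s.filter fun k => ¬ k.1 = k₀.1, k.1 < k₀.1 := fun k hk =>
      lt_of_le_of_ne (hmax k (Finset.mem_filter.1 hk).1) (Finset.mem_filter.1 hk).2
    have hpos := hlt₀ k₁ hk₁
    have h1 : (s.filter fun k => ¬ k.1 = k₀.1) ⊆
        (Finset.range (r (k₀.1 - 1))).image fun i => col i.succPNat := by
      intro k hk
      have h2 := hs k (Finset.mem_filter.1 hk).1
      obtain ⟨d, hd⟩ := exists_apply_ne_zero_of_rho_pos (ht.trans_le h2)
      have h3 := (abs_pos.2 hd).trans_le (hpart k d)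
      rw [rowPart_apply] at hd
      rw [Finsupp.smul_apply, rowPart_apply] at h3
      have hcol : col d.1.1 = k := by
        by_contra h
        simp [h] at hd
      have hxd : x k.1 d ≠ 0 := by
        intro h
        simp [h] at h3
      have h4 : (d.1.1 : ℕ) ≤ r (k₀.1 - 1) :=
        (hle _ d hxd).trans (hr (by have := hlt₀ k hk; omega))
      refine Finset.mem_image.2 ⟨(d.1.1 : ℕ) - 1, Finset.mem_range.2 ?_, ?_⟩
      · have := d.1.1.pos
        omega
      · rw [← hcol]
        congr 1
        exact PNat.succPNat_natPred d.1.1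
    have h2 : (s.filter fun k => ¬ k.1 = k₀.1).card ≤ r (k₀.1 - 1) := by
      simpa using (Finset.card_le_card h1).trans Finset.card_image_le
    have h3 : 2 * t ≤ δ k₀.1 := (h2t k₀ hk₀).trans ((hc k₀.1).rho_le k₀.2)
    refine le_trans ?_ (hδ (k₀.1 - 1) k₀.1 (by omega))
    gcongr
  have hsum : ((s.filter fun k => k.1 = k₀.1).card : ℝ)
      + ((s.filter fun k => ¬ k.1 = k₀.1).card : ℝ) = s.card := by
    exact_mod_cast s.card_filter_add_card_filter_not fun k => k.1 = k₀.1
  have h2p : (2 : ℝ) ≤ 2 ^ p := by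
    simpa using Real.rpow_le_rpow_of_exponent_le (one_le_two : (1 : ℝ) ≤ 2) hp
  rw [Real.mul_rpow zero_le_two ht.le] at hlast hfirst
  have htp : 0 < t ^ p := by positivity
  have hs0 : (0 : ℝ) ≤ (s.card : ℝ) * t ^ p := by positivity
  have h5 : (s.card : ℝ) * (2 ^ p * t ^ p) ≤ 2 := by
    rw [← hsum]
    linarith
  nlinarith

lemma linearMap_eq_pairing (g : G →ₗ[ℝ] ℝ) (x : G) :
    g x = pairing (fun d => g (Finsupp.single d 1)) x := by
  have : g = pairing fun d => g (Finsupp.single d 1) := by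
    refine Finsupp.lhom_ext' fun d => LinearMap.ext_ring ?_
    simp [pairing]
  rw [← this]

/-- The norm of a positive element is attained at a positive functional. -/
lemma exists_norming_pairing {p : ℝ} (hp : 0 < p) {z : G} (hz : ∀ d, 0 ≤ z d) :
    ∃ f : D → ℝ, (∀ d, 0 ≤ f d) ∧ (∀ x ∈ V p, pairing f x ≤ 1) ∧ tau p z ≤ pairing f z := by
  classical
  obtain ⟨g, hg, hgz⟩ := exists_dual_vector'' ℝ (show Gtau p from z)
  let g' : G →ₗ[ℝ] ℝ := g.toLinearMap
  have hg' : ∀ x : G, g' x ≤ tau p x := fun x => by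
    have h1 : ‖g (show Gtau p from x)‖ ≤ 1 * tau p x := g.le_of_opNorm_le hg _
    rw [one_mul] at h1
    exact (le_abs_self _).trans h1
  have hgz' : g' z = tau p z := hgz
  let a : D → ℝ := fun d => g' (Finsupp.single d 1)
  -- multiplying by `θ` replaces the coefficients of `g` by their positive parts
  let θ : D → ℝ := fun d => if 0 ≤ a d then 1 else 0
  have hθ : ∀ d, |θ d| ≤ 1 := fun d => by dsimp only [θ]; split_ifs <;> simp
  refine ⟨fun d => a d * θ d, fun d => ?_, fun x hx => ?_, ?_⟩
  · dsimp only [θ]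
    split_ifs with h <;> simp [h]
  · rw [pairing_mul, ← linearMap_eq_pairing]
    exact (hg' _).trans ((tau_mono hp (abs_mulBy_le hθ x)).trans (tau_le_one_of_mem_V hx))
  · rw [← hgz', linearMap_eq_pairing,
      pairing_eq_sum _ (Finset.Subset.refl z.support),
      pairing_eq_sum _ (Finset.Subset.refl z.support)]
    refine Finset.sum_le_sum fun d _ => mul_le_mul_of_nonneg_right ?_ (hz d)
    change a d ≤ a d * θ d
    dsimp only [θ]
    split_ifs with h
    · rw [mul_one]
    · rw [mul_zero]
      exact (not_le.1 h).le

lemma finite_setOf_row_le (N : ℕ) : {d : D | (d.1.1 : ℕ) ≤ N}.Finite := by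
  have h : (Set.Iic N).Finite := Set.finite_Iic N
  refine Set.Finite.of_finite_image (f := fun d : D => ((d.1.1 : ℕ), (d.1.2 : ℕ)))
    ((h.prod h).subset ?_) ?_
  · rintro _ ⟨d, hd, rfl⟩
    exact ⟨hd, le_trans (show (d.1.2 : ℕ) ≤ d.1.1 from d.2) hd⟩
  · intro d _ e _ h
    simp only [Prod.mk.injEq, PNat.coe_inj] at h
    exact Subtype.ext (Prod.ext h.1 h.2)

/-- A disjoint sequence in `V` whose sup-norms tend to zero has a subsequence for which the
finite sums of absolute values are bounded. -/
lemma exists_subseq_tau_sum_abs_le {p : ℝ} (hp : 1 < p) {y : ℕ → G} (hV : ∀ n, y n ∈ V p)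
    (hdisj : ∀ m n, m ≠ n → ∀ d, y m d ≠ 0 → y n d = 0)
    (hsup : ∀ ε : ℝ, 0 < ε → ∀ᶠ n in atTop, ∀ d, |y n d| ≤ ε) :
    ∃ φ : ℕ → ℕ, StrictMono φ ∧ ∀ S : Finset ℕ, tau p (∑ n ∈ S, |y (φ n)|) ≤ 10 := by
  classical
  have hp0 : 0 < p := by linarith
  -- `δ N` is chosen with `N (δ N)ᵖ ≤ 1`
  let δ : ℕ → ℝ := fun N => (1 / ((N : ℝ) + 1)) ^ (1 / p)
  have hδ0 : ∀ N, 0 < δ N := fun N => by positivity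
  have hδ1 : ∀ N, δ N ≤ 1 := fun N => by
    refine Real.rpow_le_one (by positivity) ?_ (by positivity)
    rw [div_le_one (by positivity)]
    linarith [(Nat.cast_nonneg N : (0 : ℝ) ≤ N)]
  have hδN : ∀ N : ℕ, (N : ℝ) * δ N ^ p ≤ 1 := fun N => by
    dsimp only [δ]
    rw [← Real.rpow_mul (by positivity), one_div_mul_cancel hp0.ne', Real.rpow_one, mul_one_div,
      div_le_one (by positivity)]
    linarith
  choose ε hε0 hε using fun N => exists_pairing_le_of_small hp (hδ0 N) (hδ1 N)
  -- a bound for the rows used by `y 0, …, y m`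
  let rb : ℕ → ℕ := fun m => (Finset.range (m + 1)).sup fun l => (y l).support.sup fun d => d.1.1
  have hrb : ∀ m d, y m d ≠ 0 → (d.1.1 : ℕ) ≤ rb m := fun m d hd =>
    (Finset.le_sup (f := fun d : D => (d.1.1 : ℕ)) (Finsupp.mem_support_iff.2 hd)).trans
      (Finset.le_sup (f := fun l => (y l).support.sup fun d => (d.1.1 : ℕ))
        (Finset.self_mem_range_succ m))
  have hrbmono : Monotone rb := fun m n hmn => Finset.sup_mono (Finset.range_mono (by omega))
  have hrows : ∀ N : ℕ, ∀ᶠ n in atTop, ∀ d, y n d ≠ 0 → N < (d.1.1 : ℕ) := by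
    intro N
    have h1 : ∀ d ∈ {d : D | (d.1.1 : ℕ) ≤ N}, ∀ᶠ n in atTop, y n d = 0 := by
      intro d _
      by_cases h : ∃ m, y m d ≠ 0
      · obtain ⟨m, hm⟩ := h
        filter_upwards [eventually_gt_atTop m] with n hn
        exact hdisj m n hn.ne d hm
      · push Not at h
        exact Eventually.of_forall h
    filter_upwards [(eventually_all_finite (finite_setOf_row_le N)).2 h1] with n hn d hd
    by_contra hcon
    exact hd (hn d (not_lt.1 hcon))
  obtain ⟨φ, hφ0, hφ⟩ := exists_seq_of_forall_finset_exists
    (fun n => ∀ d, |y n d| ≤ ε 0)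
    (fun m n => m < n ∧ (∀ d, y n d ≠ 0 → rb m < (d.1.1 : ℕ)) ∧ ∀ d, |y n d| ≤ ε (rb m)) (by
      intro s _
      have h1 := (eventually_all_finset s).2 fun m _ => (eventually_gt_atTop m).and
        ((hrows (rb m)).and (hsup (ε (rb m)) (hε0 _)))
      exact ((hsup (ε 0) (hε0 0)).and h1).exists)
  have hφmono : StrictMono φ := fun m n hmn => (hφ m n hmn).1
  refine ⟨φ, hφmono, fun S => ?_⟩
  -- the number of rows up to the block preceding the `n`-th one
  let prev : ℕ → ℕ := fun n => if n = 0 then 0 else rb (φ (n - 1))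
  have hyε : ∀ n d, |y (φ n) d| ≤ ε (prev n) := by
    intro n d
    dsimp only [prev]
    split_ifs with h
    · exact hφ0 n d
    · exact (hφ (n - 1) n (by omega)).2.2 d
  have hz0 : ∀ d, 0 ≤ (∑ n ∈ S, |y (φ n)|) d := fun d => by
    rw [Finsupp.finsetSum_apply]
    exact Finset.sum_nonneg fun n _ => by rw [abs_apply]; exact abs_nonneg _
  obtain ⟨f, hf0, hfV, hfz⟩ := exists_norming_pairing hp0 hz0
  refine hfz.trans ?_
  -- on each block, `f` is comparably large at an element of `Asmall` supported on the same rows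
  have hx : ∀ n, ∃ x ∈ Asmall p (δ (prev n)),
      (∀ d, x d ≠ 0 → ∃ e : D, e.1.1 = d.1.1 ∧ y (φ n) e ≠ 0) ∧
      pairing f |y (φ n)| ≤ 5 * pairing f x := by
    intro n
    set a := pairing f |y (φ n)| with ha
    rcases le_or_gt a 0 with ha0 | ha0
    · obtain ⟨ι, c, hc⟩ := A_subset_Asmall_one hp0 (zero_mem_A p)
      have hc0 : ∀ k, rowPart c k (0 : G) = 0 := fun k => Finsupp.filter_zero _
      refine ⟨0, ⟨ι, c, hc.mem_U, fun k => ?_, hc.card_le⟩, by simp, by simpa using ha0⟩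
      rw [hc0, rho_zero]
      exact (hδ0 _).le
    let θ : D → ℝ := fun d => if ∃ e : D, e.1.1 = d.1.1 ∧ y (φ n) e ≠ 0 then 1 else 0
    have hθ0 : ∀ d, 0 ≤ θ d := fun d => by dsimp only [θ]; split_ifs <;> simp
    have hθ1 : ∀ d, |θ d| ≤ 1 := fun d => by dsimp only [θ]; split_ifs <;> simp
    obtain ⟨x, hx, hxa⟩ : ∃ x ∈ Asmall p (δ (prev n)), a ≤ 5 * pairing f (mulBy θ x) := by
      by_contra! hcon
      have hpair : ∀ x, pairing (fun d => f d * (θ d * (5 / a))) x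
          = 5 / a * pairing f (mulBy θ x) := fun x => by
        rw [pairing_mul, ← smul_eq_mul, ← map_smul]
        congr 1
        ext d
        simp only [mulBy_apply, Finsupp.smul_apply, smul_eq_mul]
        ring
      have h1 := hε (prev n) (fun d => f d * (θ d * (5 / a)))
        (fun d => by have := hf0 d; have := hθ0 d; positivity)
        (fun x hx => by
          rw [hpair, div_mul_eq_mul_div, div_le_one ha0]
          exact (hcon x hx).le)
        |y (φ n)| (mem_V_of_abs_le hp0 (hV (φ n)) fun d => by rw [abs_apply, abs_abs])
        (fun d => by rw [abs_apply, abs_abs]; exact hyε n d)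
      have h2 : mulBy θ |y (φ n)| = |y (φ n)| := by
        ext d
        rw [mulBy_apply, abs_apply]
        by_cases hd : y (φ n) d = 0
        · simp [hd]
        · have : ∃ e : D, e.1.1 = d.1.1 ∧ y (φ n) e ≠ 0 := ⟨d, rfl, hd⟩
          simp only [θ, if_pos this, one_mul]
      rw [hpair, h2, ← ha, div_mul_cancel₀ _ ha0.ne'] at h1
      norm_num at h1
    refine ⟨mulBy θ x, Asmall_of_abs_le hx (abs_mulBy_le hθ1 x), fun d hd => ?_, hxa⟩
    by_contra hcon
    exact hd (by rw [mulBy_apply, show θ d = 0 from if_neg hcon, zero_mul])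
  choose x hxA hxrow hxf using hx
  have hhalf := half_sum_mem_A hp.le (r := fun n => rb (φ n)) hxA
    (fun n d hd => by
      obtain ⟨e, he, hne⟩ := hxrow n d hd
      rw [← he]
      exact hrb _ e hne)
    (fun m n hmn d hd => by
      obtain ⟨e, he, hne⟩ := hxrow n d hd
      rw [← he]
      exact (hφ m n hmn).2.1 e hne)
    (hrbmono.comp hφmono.monotone)
    (fun m n hmn => by
      have h1 : rb (φ m) ≤ prev n := by
        dsimp only [prev]
        rw [if_neg (by omega)]
        exact hrbmono (hφmono.monotone (by omega))
      refine le_trans ?_ (hδN (prev n))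
      have := hδ0 (prev n)
      gcongr) S
  have h1 := hfV _ (subset_convexHull ℝ _ hhalf)
  rw [map_smul, map_sum, smul_eq_mul] at h1
  rw [map_sum]
  calc ∑ n ∈ S, pairing f |y (φ n)| ≤ ∑ n ∈ S, 5 * pairing f (x n) :=
        Finset.sum_le_sum fun n _ => hxf n
    _ = 5 * ∑ n ∈ S, pairing f (x n) := by rw [Finset.mul_sum]
    _ ≤ 10 := by linarith

lemma norm_sum_smul_toE {p : ℝ} (y : ℕ → G) (a : ℕ →₀ ℝ) :
    ‖a.sum fun k t => t • toE p (y k)‖ = tau p (a.sum fun k t => t • y k) := by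
  rw [← norm_toE, Finsupp.sum, Finsupp.sum, map_sum]
  simp only [map_smul]

lemma bddAbove_range_abs (a : ℕ →₀ ℝ) : BddAbove (Set.range fun k => |a k|) := by
  refine (Set.Finite.subset ((a.support.image fun k => |a k|) ∪ {0}).finite_toSet ?_).bddAbove
  rintro _ ⟨k, rfl⟩
  by_cases hk : a k = 0
  · simp [hk]
  · have : ∃ l, a l ≠ 0 ∧ |a l| = |a k| := ⟨k, hk, rfl⟩
    simp [this]

lemma abs_le_iSup_abs (a : ℕ →₀ ℝ) (k : ℕ) : |a k| ≤ ⨆ k, |a k| :=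
  le_ciSup (bddAbove_range_abs a) k

lemma iSup_abs_nonneg (a : ℕ →₀ ℝ) : 0 ≤ ⨆ k, |a k| := Real.iSup_nonneg fun _ => abs_nonneg _

/-- Disjoint sums dominate their summands. -/
lemma abs_mul_tau_le_tau_sum {p : ℝ} (hp : 0 < p) {y : ℕ → G}
    (hdisj : ∀ m n, m ≠ n → ∀ d, y m d ≠ 0 → y n d = 0) (a : ℕ →₀ ℝ) (k : ℕ) :
    |a k| * tau p (y k) ≤ tau p (a.sum fun k t => t • y k) := by
  rw [← tau_smul]
  refine tau_mono hp fun d => ?_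
  by_cases hd : (a k • y k) d = 0
  · rw [hd, abs_zero]
    exact abs_nonneg _
  · rw [Finsupp.smul_apply, smul_eq_mul] at hd
    have hak : k ∈ a.support := Finsupp.mem_support_iff.2 (left_ne_zero_of_mul hd)
    rw [Finsupp.sum, Finsupp.finsetSum_apply, Finset.sum_eq_single_of_mem k hak]
    intro l _ hl
    rw [Finsupp.smul_apply, hdisj k l hl.symm d (right_ne_zero_of_mul hd), smul_zero]

/-- Disjoint normalized sequences with sup-norms tending to zero have subsequences
equivalent to the unit vector basis of `c₀`. -/
theorem exists_subseq_equivC0Basis {p : ℝ} (hp : 1 < p) {y : ℕ → G}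
    (hnorm : ∀ n, tau p (y n) = 1)
    (hdisj : ∀ m n, m ≠ n → ∀ d, y m d ≠ 0 → y n d = 0)
    (hsup : ∀ ε : ℝ, 0 < ε → ∀ᶠ n in atTop, ∀ d, |y n d| ≤ ε) :
    ∃ φ : ℕ → ℕ, StrictMono φ ∧ EquivC0Basis fun k => toE p (y (φ k)) := by
  have hp0 : 0 < p := by linarith
  have hhalf : ∀ n d, |((1 / 2 : ℝ) • y n) d| = 1 / 2 * |y n d| := fun n d => by
    rw [Finsupp.smul_apply, smul_eq_mul, abs_mul, abs_of_pos (by norm_num)]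
  obtain ⟨φ, hφ, hbound⟩ := exists_subseq_tau_sum_abs_le hp (y := fun n => (1 / 2 : ℝ) • y n)
    (fun n => mem_V_of_tau_lt_one (by rw [tau_smul, hnorm]; norm_num))
    (fun m n hmn d hd => by
      have : y m d ≠ 0 := fun h => hd (by simp [h])
      simp [hdisj m n hmn d this])
    (fun ε hε => by
      filter_upwards [hsup ε hε] with n hn d
      rw [hhalf]
      linarith [hn d, abs_nonneg (y n d)])
  refine ⟨φ, hφ, 1, 20, one_pos, by norm_num, fun a => ?_⟩
  rw [norm_sum_smul_toE]
  constructor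
  · rw [one_mul]
    refine ciSup_le fun k => ?_
    have := abs_mul_tau_le_tau_sum hp0 (y := fun k => y (φ k))
      (fun m n hmn => hdisj _ _ (hφ.injective.ne hmn)) a k
    rwa [hnorm, mul_one] at this
  · set M := ⨆ k, |a k|
    have hM : 0 ≤ M := iSup_abs_nonneg a
    have hle : ∀ d, |(a.sum fun k t => t • y (φ k)) d|
        ≤ |((2 * M) • ∑ n ∈ a.support, |(1 / 2 : ℝ) • y (φ n)|) d| := by
      intro d
      rw [Finsupp.sum, Finsupp.finsetSum_apply, Finsupp.smul_apply, Finsupp.finsetSum_apply,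
        smul_eq_mul]
      refine le_trans ?_ (le_abs_self _)
      refine (Finset.abs_sum_le_sum_abs _ _).trans ?_
      rw [Finset.mul_sum]
      refine Finset.sum_le_sum fun k _ => ?_
      rw [abs_apply, hhalf, Finsupp.smul_apply, smul_eq_mul, abs_mul]
      have h1 := mul_le_mul_of_nonneg_right (abs_le_iSup_abs a k) (abs_nonneg (y (φ k) d))
      linarith
    refine (tau_mono hp0 hle).trans ?_
    rw [tau_smul, abs_of_nonneg (by positivity)]
    have := mul_le_mul_of_nonneg_left (hbound a.support) (show 0 ≤ 2 * M by positivity)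
    linarith

/-! ### The unit vector basis -/

lemma denseRange_toE (p : ℝ) : DenseRange (toE p) :=
  UniformSpace.Completion.denseRange_coe (α := Gtau p)

lemma abs_lapply_le (p : ℝ) (d : D) (x : G) :
    ‖(Finsupp.lapply d : G →ₗ[ℝ] ℝ) x‖ ≤ 1 * ‖toE p x‖ := by
  rw [norm_toE, one_mul]
  exact abs_apply_le_tau p x d

/-- The coordinate functional of `E` at the point `d`. -/
noncomputable def coordE (p : ℝ) (d : D) : StrongDual ℝ (E p) :=
  (Finsupp.lapply d : G →ₗ[ℝ] ℝ).extendOfNorm (toE p)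

@[simp]
lemma coordE_toE (p : ℝ) (d : D) (x : G) : coordE p d (toE p x) = x d :=
  LinearMap.extendOfNorm_eq (denseRange_toE p) ⟨1, abs_lapply_le p d⟩ x

lemma abs_coordE_le (p : ℝ) (d : D) (x : E p) : |coordE p d x| ≤ ‖x‖ := by
  have := LinearMap.norm_extendOfNorm_apply_le (denseRange_toE p) 1 (abs_lapply_le p d) x
  rwa [one_mul] at this

/-- The restriction of `x ∈ E` to a finite set of coordinates. -/
noncomputable def restr {p : ℝ} (F : Finset D) (x : E p) : G :=
  Finsupp.indicator F fun d _ => coordE p d x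

open scoped Classical in
lemma restr_apply {p : ℝ} (F : Finset D) (x : E p) (d : D) :
    restr F x d = if d ∈ F then coordE p d x else 0 := by
  rw [restr, Finsupp.indicator_apply]
  simp

lemma toE_restr {p : ℝ} (F : Finset D) (x : E p) :
    toE p (restr F x) = ∑ d ∈ F, coordE p d x • toE p (Finsupp.single d 1) := by
  classical
  have : restr F x = ∑ d ∈ F, coordE p d x • Finsupp.single d (1 : ℝ) := by
    ext e
    rw [restr_apply, Finsupp.finsetSum_apply]
    simp [Finsupp.single_apply]
  rw [this, map_sum]
  simp only [map_smul]

lemma norm_toE_restr_le {p : ℝ} (hp : 0 < p) (F : Finset D) (x : E p) :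
    ‖toE p (restr F x)‖ ≤ ‖x‖ := by
  refine (denseRange_toE p).induction_on x ?_ fun g => ?_
  · simp only [toE_restr]
    exact isClosed_le (by fun_prop) (by fun_prop)
  · rw [norm_toE, norm_toE]
    refine tau_mono hp fun d => ?_
    rw [restr_apply, coordE_toE]
    split_ifs
    · rfl
    · simp

lemma restr_sub {p : ℝ} (F : Finset D) (x y : E p) : restr F (x - y) = restr F x - restr F y := by
  ext d
  simp only [restr_apply, Finsupp.sub_apply, map_sub]
  split_ifs <;> simp

/-- The finite restrictions converge to the identity; the restriction operators are contractive,
so it suffices to look at the dense subspace `G`. -/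
lemma tendsto_toE_restr {p : ℝ} (hp : 0 < p) (x : E p) :
    Tendsto (fun F : Finset D => toE p (restr F x)) atTop (𝓝 x) := by
  rw [Metric.tendsto_nhds]
  intro ε hε
  obtain ⟨g, hg⟩ := (denseRange_toE p).exists_dist_lt x (half_pos hε)
  filter_upwards [eventually_ge_atTop g.support] with F hF
  have h1 : restr F (toE p g) = g := by
    ext d
    rw [restr_apply, coordE_toE]
    split_ifs with h
    · rfl
    · by_contra hne
      exact h (hF (Finsupp.mem_support_iff.2 (Ne.symm hne)))
  have h2 : toE p (restr F x) - x = toE p (restr F (x - toE p g)) - (x - toE p g) := by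
    rw [restr_sub, h1, map_sub]
    abel
  rw [dist_eq_norm, h2]
  rw [dist_eq_norm] at hg
  have h3 := norm_sub_le (toE p (restr F (x - toE p g))) (x - toE p g)
  have h4 := norm_toE_restr_le hp F (x - toE p g)
  linarith

/-- The unit vectors form an unconditional basis of `E`. -/
noncomputable def unitVectorBasis {p : ℝ} (hp : 0 < p) :
    UnconditionalSchauderBasis D ℝ (E p) where
  basis d := toE p (Finsupp.single d 1)
  coord := coordE p
  ortho i j := by
    -- `Pi.single` carries the classical decidability instance here
    rw [coordE_toE]
    by_cases h : i = j
    · subst h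
      rw [Finsupp.single_eq_same]
      exact (@Pi.single_eq_same D (fun _ => ℝ) _
        (fun a b => Classical.propDecidable (a = b)) i 1).symm
    · rw [Finsupp.single_eq_of_ne h]
      exact (@Pi.single_eq_of_ne D (fun _ => ℝ) _
        (fun a b => Classical.propDecidable (a = b)) j i h 1).symm
  expansion x := by
    have := tendsto_toE_restr hp x
    simp only [toE_restr] at this
    exact this

/-! ### The quotient map onto `ℓ²` -/

lemma rowSum_sum_sq_le {m : ℕ} {y : Fin m → G}
    (hrow : Pairwise fun k l => RowDisjoint (y k) (y l)) (i : ℕ+) :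
    rowSum (∑ k, y k) i ^ 2 ≤ ∑ k, rowSum (y k) i ^ 2 := by
  by_cases h : ∃ k, rowSum (y k) i ≠ 0
  · obtain ⟨k, hk⟩ := h
    have h1 : rowSum (∑ k, y k) i = rowSum (y k) i := by
      refine Finset.sum_congr rfl fun j _ => ?_
      rw [Finsupp.finsetSum_apply, Finset.sum_eq_single k]
      · intro l _ hl
        exact apply_eq_zero_of_rowSum ((mul_eq_zero.1 (hrow hl i)).resolve_right hk)
      · simp
    rw [h1]
    exact Finset.single_le_sum (f := fun k => rowSum (y k) i ^ 2)
      (fun l _ => sq_nonneg _) (Finset.mem_univ k)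
  · push Not at h
    have h1 : rowSum (∑ k, y k) i = 0 := by
      refine rowSum_eq_zero_iff.2 fun d hd => ?_
      rw [Finsupp.finsetSum_apply]
      exact Finset.sum_eq_zero fun k _ => rowSum_eq_zero_iff.1 (h k) d hd
    rw [h1, zero_pow two_ne_zero]
    exact Finset.sum_nonneg fun k _ => sq_nonneg _

lemma rho_sum_sq_le {m : ℕ} {y : Fin m → G}
    (hrow : Pairwise fun k l => RowDisjoint (y k) (y l)) :
    rho (∑ k, y k) ^ 2 ≤ ∑ k, rho (y k) ^ 2 := by
  have h0 : 0 ≤ ∑ k, rho (y k) ^ 2 := Finset.sum_nonneg fun k _ => sq_nonneg _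
  have h1 : rho (∑ k, y k) ≤ √(∑ k, rho (y k) ^ 2) := by
    refine (rho_le_iff (Real.sqrt_nonneg _)).2 fun I => ?_
    rw [Real.sq_sqrt h0]
    calc ∑ i ∈ I, (1 / (i : ℝ) * rowSum (∑ k, y k) i) ^ 2
        ≤ ∑ i ∈ I, ∑ k, (1 / (i : ℝ) * rowSum (y k) i) ^ 2 := by
          refine Finset.sum_le_sum fun i _ => ?_
          simp only [mul_pow, ← Finset.mul_sum]
          gcongr
          exact rowSum_sum_sq_le hrow i
      _ = ∑ k, ∑ i ∈ I, (1 / (i : ℝ) * rowSum (y k) i) ^ 2 := Finset.sum_comm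
      _ ≤ ∑ k, rho (y k) ^ 2 := Finset.sum_le_sum fun k _ => sum_le_rho_sq (y k) I
  calc rho (∑ k, y k) ^ 2 ≤ √(∑ k, rho (y k) ^ 2) ^ 2 := by
        have := rho_nonneg (∑ k, y k)
        gcongr
    _ = _ := Real.sq_sqrt h0

/-- For `p < 2` the weak `ℓᵖ` unit ball is bounded in `ℓ²`. -/
lemma exists_sum_sq_le_of_lorentz_le_one {p : ℝ} (hp0 : 0 < p) (hp2 : p < 2) :
    ∃ C : ℝ, 0 ≤ C ∧ ∀ (m : ℕ) (a : Fin m → ℝ), lorentz p a ≤ 1 → ∑ k, a k ^ 2 ≤ C := by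
  have hs : Summable fun n : ℕ => 1 / ((n : ℝ) + 1) ^ (2 / p) := by
    have h1 : Summable fun n : ℕ => 1 / (n : ℝ) ^ (2 / p) :=
      Real.summable_one_div_nat_rpow.2 (by rwa [lt_div_iff₀ hp0, one_mul])
    have h2 := (summable_nat_add_iff 1).2 h1
    simpa using h2
  refine ⟨∑' n : ℕ, 1 / ((n : ℝ) + 1) ^ (2 / p), tsum_nonneg fun n => by positivity,
    fun m a ha => ?_⟩
  have h1 : ∑ k, a k ^ 2 = ∑ n, decRearr a n ^ 2 := by
    simp only [decRearr, sq_abs]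
    exact (Equiv.sum_comp (Tuple.sort fun k => -|a k|) fun k => a k ^ 2).symm
  have h2 : ∀ n : Fin m, decRearr a n ^ 2 ≤ 1 / (((n : ℕ) : ℝ) + 1) ^ (2 / p) := by
    intro n
    have h3 : decRearr a n * ((n : ℝ) + 1) ^ (1 / p) ≤ 1 :=
      (le_ciSup (f := fun n : Fin m => decRearr a n * ((n : ℝ) + 1) ^ (1 / p))
        (Set.finite_range _).bddAbove n).trans ha
    have h4 : (((n : ℕ) : ℝ) + 1) ^ (2 / p) = ((((n : ℕ) : ℝ) + 1) ^ (1 / p)) ^ 2 := by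
      rw [← Real.rpow_natCast, ← Real.rpow_mul (by positivity)]
      congr 1
      push_cast
      ring
    have h5 := decRearr_nonneg a n
    rw [h4, le_div_iff₀ (by positivity), ← mul_pow]
    exact pow_le_one₀ (by positivity) h3
  rw [h1]
  calc ∑ n, decRearr a n ^ 2 ≤ ∑ n : Fin m, 1 / (((n : ℕ) : ℝ) + 1) ^ (2 / p) :=
        Finset.sum_le_sum fun n _ => h2 n
    _ = ∑ n ∈ Finset.range m, 1 / ((n : ℝ) + 1) ^ (2 / p) :=
        Fin.sum_univ_eq_sum_range (fun n : ℕ => 1 / ((n : ℝ) + 1) ^ (2 / p)) m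
    _ ≤ _ := hs.sum_le_tsum _ fun n _ => by positivity

/-- The Hilbert space `ℓ²`. -/
abbrev L2 : Type := lp (fun _ : ℕ => ℝ) 2

/-- The rows `2, 4, 8, …` are sparse enough for the rounding errors in the construction of
preimages to be square summable with a small sum. -/
def sparseRow : ℕ ↪ ℕ+ where
  toFun n := 2 ^ (n + 1)
  inj' m n h := by
    have h1 : (((2 : ℕ+) ^ (m + 1) : ℕ+) : ℕ) = (((2 : ℕ+) ^ (n + 1) : ℕ+) : ℕ) :=
      congrArg PNat.val h
    rw [PNat.pow_coe, PNat.pow_coe] at h1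
    exact Nat.succ_injective (Nat.pow_right_injective le_rfl h1)

lemma sparseRow_coe (n : ℕ) : ((sparseRow n : ℕ+) : ℝ) = 2 ^ (n + 1) := by
  change (((2 : ℕ+) ^ (n + 1) : ℕ+) : ℝ) = _
  push_cast
  rfl

/-- The average of `x` over the row `i`. -/
noncomputable def rowAvg (x : G) (i : ℕ+) : ℝ :=
  1 / (i : ℝ) * ∑ j : Set.Iic i, x ⟨(i, j.1), j.2⟩

lemma rowAvg_sq_le (x : G) (i : ℕ+) : rowAvg x i ^ 2 ≤ (1 / (i : ℝ) * rowSum x i) ^ 2 := by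
  rw [rowAvg, mul_pow, mul_pow]
  gcongr ?_ * ?_
  rw [← sq_abs]
  gcongr
  exact Finset.abs_sum_le_sum_abs _ _

/-- The sequence of the averages over the sparse rows. -/
noncomputable def avgMap : G →ₗ[ℝ] L2 where
  toFun x := ⟨fun n => rowAvg x (sparseRow n), by
    refine memℓp_gen ?_
    simp only [ENNReal.toReal_ofNat, Real.rpow_ofNat, Real.norm_eq_abs, sq_abs]
    exact Summable.of_nonneg_of_le (fun n => sq_nonneg _) (fun n => rowAvg_sq_le x _)
      ((summable_rho x).comp_injective sparseRow.injective)⟩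
  map_add' x y := by
    ext n
    change rowAvg (x + y) _ = rowAvg x _ + rowAvg y _
    simp [rowAvg, Finset.sum_add_distrib, mul_add]
  map_smul' c x := by
    ext n
    change rowAvg (c • x) _ = c * rowAvg x _
    simp only [rowAvg, Finsupp.smul_apply, smul_eq_mul, ← Finset.mul_sum]
    ring

lemma avgMap_apply (x : G) (n : ℕ) : avgMap x n = rowAvg x (sparseRow n) := rfl

lemma norm_avgMap_le_rho (x : G) : ‖avgMap x‖ ≤ rho x := by
  refine lp.norm_le_of_forall_sum_le (by norm_num) (rho_nonneg x) fun s => ?_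
  simp only [ENNReal.toReal_ofNat, Real.rpow_ofNat, Real.norm_eq_abs, sq_abs, avgMap_apply]
  refine (Finset.sum_le_sum fun n _ => rowAvg_sq_le x (sparseRow n)).trans ?_
  have := sum_le_rho_sq x (s.map sparseRow)
  rwa [Finset.sum_map] at this

lemma exists_norm_avgMap_le {p : ℝ} (hp0 : 0 < p) (hp2 : p < 2) :
    ∃ C : ℝ, ∀ x, ‖avgMap x‖ ≤ C * ‖toE p x‖ := by
  obtain ⟨C, hC0, hC⟩ := exists_sum_sq_le_of_lorentz_le_one hp0 hp2
  have hV : V p ⊆ avgMap ⁻¹' Metric.closedBall 0 √C := by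
    refine convexHull_min ?_ ((convex_closedBall (0 : L2) _).linear_preimage avgMap)
    rintro x ⟨m, y, -, -, hrow, hl, rfl⟩
    rw [Set.mem_preimage, mem_closedBall_zero_iff]
    exact (norm_avgMap_le_rho _).trans
      (Real.le_sqrt_of_sq_le ((rho_sum_sq_le hrow).trans (hC m _ hl)))
  refine ⟨√C, fun x => ?_⟩
  rw [norm_toE]
  refine le_mul_tau_of_forall_mem_V (q := fun x => ‖avgMap x‖) (fun c x hc => ?_)
    (fun x hx => ?_) x
  · rw [map_smul, norm_smul, Real.norm_of_nonneg hc]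
  · simpa using hV hx

/-- The quotient map of `E` onto `ℓ²`. -/
noncomputable def quotientMap (p : ℝ) : E p →L[ℝ] L2 := avgMap.extendOfNorm (toE p)

lemma quotientMap_toE {p : ℝ} (hp0 : 0 < p) (hp2 : p < 2) (x : G) :
    quotientMap p (toE p x) = avgMap x :=
  LinearMap.extendOfNorm_eq (denseRange_toE p) (exists_norm_avgMap_le hp0 hp2) x

lemma sum_range_ite_lt {i m : ℕ} (h : m ≤ i) :
    ∑ k ∈ Finset.range i, (if k + 1 ≤ m then (1 : ℝ) else 0) = m := by
  rw [Finset.sum_ite, Finset.sum_const_zero, add_zero, Finset.sum_const, nsmul_eq_mul, mul_one]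
  congr 1
  rw [show (Finset.range i).filter (fun k => k + 1 ≤ m) = Finset.range m by
    ext k
    simp only [Finset.mem_filter, Finset.mem_range]
    omega, Finset.card_range]

lemma sum_two_div_sparseRow_sq_le (s : Finset ℕ) :
    ∑ n ∈ s, 2 / ((sparseRow n : ℕ+) : ℝ) ^ 2 ≤ 2 / 3 := by
  have h1 : HasSum (fun n : ℕ => 1 / 2 * (1 / 4 : ℝ) ^ n) (1 / 2 * (1 - 1 / 4)⁻¹) :=
    (hasSum_geometric_of_lt_one (by norm_num) (by norm_num)).mul_left _
  have h2 : ∀ n : ℕ, 2 / ((sparseRow n : ℕ+) : ℝ) ^ 2 = 1 / 2 * (1 / 4 : ℝ) ^ n := fun n => by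
    rw [sparseRow_coe, ← pow_mul, mul_comm, pow_mul, pow_succ, one_div_pow]
    norm_num
    field_simp
    norm_num
  rw [Finset.sum_congr rfl fun n _ => h2 n]
  refine (sum_le_hasSum s (fun n _ => by positivity) h1).trans ?_
  norm_num

/-- Finitely supported elements of a ball of `ℓ²` have preimages in `U`: round the coordinates up
to admissible multiples and correct the resulting `x_b` by a factor of modulus at most `1` on
each row. -/
lemma exists_mem_U_avgMap_eq (h : ℕ →₀ ℝ) (hh : ∑ n ∈ h.support, h n ^ 2 ≤ 1 / 6) :
    ∃ x ∈ U, ∀ n, avgMap x n = h n := by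
  classical
  let i : ℕ → ℝ := fun n => ((sparseRow n : ℕ+) : ℝ)
  have hi : ∀ n, 0 < i n := fun n => by
    dsimp only [i]
    exact_mod_cast (sparseRow n).pos
  let c : ℕ → ℕ := fun n => ⌈i n * |h n|⌉₊
  have hc0 : ∀ n, h n = 0 → c n = 0 := fun n hn => by simp [c, hn]
  have hhc : ∀ n, |h n| ≤ c n / i n := fun n => by
    rw [le_div_iff₀ (hi n), mul_comm]
    exact Nat.le_ceil _
  have hch : ∀ n, (c n : ℝ) / i n ≤ |h n| + 1 / i n := fun n => by
    have h1 : (c n : ℝ) < i n * |h n| + 1 := Nat.ceil_lt_add_one (by have := hi n; positivity)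
    rw [div_le_iff₀ (hi n), add_mul, one_div_mul_cancel (hi n).ne']
    linarith
  have hh1 : ∀ n, |h n| ≤ 1 := fun n => by
    by_cases hn : h n = 0
    · simp [hn]
    · have h1 := Finset.single_le_sum (f := fun n => h n ^ 2) (fun n _ => sq_nonneg _)
        (Finsupp.mem_support_iff.2 hn)
      have h2 : h n ^ 2 ≤ 1 := (h1.trans hh).trans (by norm_num)
      exact abs_le_one_iff_mul_self_le_one.2 (by nlinarith)
  have hci : ∀ n, c n ≤ (sparseRow n : ℕ) := fun n => by
    refine Nat.ceil_le.2 ?_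
    exact mul_le_of_le_one_right (hi n).le (hh1 n)
  let v : ℕ →₀ ℝ := Finsupp.onFinset h.support (fun n => c n / i n) fun n hn => by
    rw [Finsupp.mem_support_iff]
    intro h0
    simp [hc0 n h0] at hn
  have hv : ∀ n, v n = c n / i n := fun n => rfl
  let b : ℕ+ →₀ ℝ := v.embDomain sparseRow
  have hb : ∀ n, b (sparseRow n) = c n / i n := fun n => by
    rw [← hv]
    exact Finsupp.embDomain_apply_self _ _ _
  have hbB : b ∈ B := by
    refine ⟨fun k => ?_, ?_⟩
    · by_cases hk : k ∈ Set.range sparseRow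
      · obtain ⟨n, rfl⟩ := hk
        refine ⟨c n, ?_⟩
        rw [hb]
        exact mul_div_cancel₀ _ (hi n).ne'
      · exact ⟨0, by simp [b, Finsupp.embDomain_of_notMem_range _ _ _ hk]⟩
    · rw [l2norm, Real.sqrt_le_left zero_le_one, one_pow,
        tsum_eq_sum (s := b.support) fun k hk => by simpa using hk]
      rw [Finsupp.support_embDomain, Finset.sum_map]
      calc ∑ n ∈ v.support, b (sparseRow n) ^ 2
          ≤ ∑ n ∈ h.support, b (sparseRow n) ^ 2 :=
            Finset.sum_le_sum_of_subset_of_nonneg Finsupp.support_onFinset_subset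
              fun n _ _ => sq_nonneg _
        _ ≤ ∑ n ∈ h.support, (2 * h n ^ 2 + 2 / i n ^ 2) := by
            refine Finset.sum_le_sum fun n _ => ?_
            rw [hb]
            have h1 : ((c n : ℝ) / i n) ^ 2 ≤ (|h n| + 1 / i n) ^ 2 := by
              have := hi n
              gcongr
              exact hch n
            have h2 : 2 / i n ^ 2 = 2 * (1 / i n) ^ 2 := by rw [one_div, inv_pow]; rfl
            rw [h2, ← sq_abs (h n)]
            nlinarith [sq_nonneg (|h n| - 1 / i n)]
        _ = 2 * ∑ n ∈ h.support, h n ^ 2 + ∑ n ∈ h.support, 2 / i n ^ 2 := by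
            rw [Finset.sum_add_distrib, Finset.mul_sum]
        _ ≤ 2 * (1 / 6) + 2 / 3 := by
            gcongr
            exact sum_two_div_sparseRow_sq_le _
        _ = 1 := by norm_num
  -- the correction factors on the rows; where `v n = 0` also `h n = 0`, and `0 / 0 = 0` is harmless
  let t : ℕ+ →₀ ℝ := (Finsupp.onFinset h.support (fun n => h n / v n) fun n hn => by
    rw [Finsupp.mem_support_iff]
    intro h0
    simp [h0] at hn : ℕ →₀ ℝ).embDomain sparseRow
  have ht : ∀ n, t (sparseRow n) = h n / v n := fun n => Finsupp.embDomain_apply_self _ _ _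
  have ht1 : ∀ k, |t k| ≤ 1 := fun k => by
    by_cases hk : k ∈ Set.range sparseRow
    · obtain ⟨n, rfl⟩ := hk
      rw [ht, abs_div]
      refine div_le_one_of_le₀ ?_ (abs_nonneg _)
      rw [hv]
      exact (hhc n).trans (le_abs_self _)
    · simp [t, Finsupp.embDomain_of_notMem_range _ _ _ hk]
  refine ⟨mulBy (fun d => t d.1.1) (xb b),
    mem_U_of_abs_le (xb_mem_U hbB) (abs_mulBy_le (fun d => ht1 _) _), fun n => ?_⟩
  have hsum : ∑ j : Set.Iic (sparseRow n), xb b ⟨(sparseRow n, j.1), j.2⟩ = c n := by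
    rw [← sum_range_ite_lt (hci n)]
    refine Eq.trans ?_ (sum_Iic_eq_sum_range (sparseRow n) fun m : ℕ =>
      if m ≤ c n then (1 : ℝ) else 0)
    refine Finset.sum_congr rfl fun j _ => ?_
    change (if ((j.1 : ℕ) : ℝ) ≤ i n * b (sparseRow n) then (1 : ℝ) else 0) = _
    rw [hb, mul_div_cancel₀ _ (hi n).ne']
    simp only [Nat.cast_le]
  rw [avgMap_apply, rowAvg]
  simp only [mulBy_apply]
  rw [← Finset.mul_sum, hsum, ht, hv]
  change 1 / i n * (h n / (c n / i n) * c n) = h n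
  by_cases hn : c n = 0
  · have := hhc n
    rw [hn] at this
    simp only [Nat.cast_zero, zero_div] at this
    rw [abs_nonpos_iff.1 this]
    simp
  · have h1 : (c n : ℝ) ≠ 0 := by exact_mod_cast hn
    have h2 := (hi n).ne'
    field_simp

/-- The finitely supported sequences in `ℓ²`. -/
def finSuppL2 : AddSubgroup L2 where
  carrier := {h | (Function.support fun n => h n).Finite}
  zero_mem' := by simp
  add_mem' {g h} hg hh := (hg.union hh).subset fun n hn => by
    by_contra hcon
    simp only [Set.mem_union, Function.mem_support, not_or, not_not] at hcon
    exact hn (by simp [hcon.1, hcon.2])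
  neg_mem' {h} hh := hh.subset fun n hn => by simpa using hn

lemma topologicalClosure_finSuppL2 : finSuppL2.topologicalClosure = ⊤ := by
  rw [eq_top_iff]
  intro h _
  refine mem_closure_of_tendsto (lp.hasSum_single (by norm_num) h)
    (Eventually.of_forall fun s => sum_mem fun n _ => ?_)
  refine (Set.finite_singleton n).subset fun k hk => ?_
  by_contra hne
  refine hk ?_
  change (lp.single 2 n (h n) : L2) k = 0
  rw [lp.single_apply]
  exact dif_neg hne

lemma surjective_quotientMap {p : ℝ} (hp0 : 0 < p) (hp2 : p < 2) :
    Function.Surjective (quotientMap p) := by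
  let f : NormedAddGroupHom (E p) L2 :=
    (quotientMap p : E p →+ L2).mkNormedAddGroupHom ‖quotientMap p‖ (quotientMap p).le_opNorm
  have hf : f.SurjectiveOnWith finSuppL2 (5 / 2) := by
    intro h hh
    by_cases h0 : h = 0
    · exact ⟨0, by simp [h0], by simp [h0]⟩
    have hpos : 0 < ‖h‖ := norm_pos_iff.2 h0
    -- rescale to norm `2 / 5`, since `(2 / 5)² ≤ 1 / 6`
    set s : ℝ := 2 / 5 / ‖h‖ with hs
    have hs0 : 0 < s := by positivity
    let h' : ℕ →₀ ℝ := Finsupp.ofSupportFinite (fun n => (s • h) n) (hh.subset fun n hn => by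
      rw [Function.mem_support, lp.coeFn_smul, Pi.smul_apply, smul_eq_mul] at hn
      exact right_ne_zero_of_mul hn)
    have hh' : ∀ n, h' n = (s • h) n := fun n => rfl
    obtain ⟨x, hxU, hx⟩ := exists_mem_U_avgMap_eq h' (by
      have h1 := lp.sum_rpow_le_norm_rpow (p := 2) (by norm_num) (s • h) h'.support
      simp only [ENNReal.toReal_ofNat, Real.rpow_ofNat, Real.norm_eq_abs, sq_abs] at h1
      simp only [hh']
      refine h1.trans ?_
      rw [norm_smul, Real.norm_of_nonneg hs0.le, hs, div_mul_cancel₀ _ hpos.ne']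
      norm_num)
    have hx' : avgMap x = s • h := by
      ext n
      rw [hx, hh']
    refine ⟨s⁻¹ • toE p x, ?_, ?_⟩
    · change quotientMap p (s⁻¹ • toE p x) = h
      rw [map_smul, quotientMap_toE hp0 hp2, hx', smul_smul, inv_mul_cancel₀ hs0.ne', one_smul]
    · rw [norm_smul, norm_toE, Real.norm_of_nonneg (inv_pos.2 hs0).le]
      have h1 : tau p x ≤ 1 :=
        tau_le_one_of_mem_V (subset_convexHull ℝ _ (U_subset_A hxU))
      calc s⁻¹ * tau p x ≤ s⁻¹ * 1 := by gcongr
        _ = 5 / 2 * ‖h‖ := by rw [hs, mul_one, inv_div]; ring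
  have hclos := controlled_closure_of_complete (by norm_num) one_pos hf
  intro h
  obtain ⟨x, hx, -⟩ := hclos h (by rw [topologicalClosure_finSuppL2]; trivial)
  exact ⟨x, hx⟩

/-- The space `ℓ²` is isomorphic to a quotient of `E`. -/
theorem exists_quotient_equiv_L2 {p : ℝ} (hp0 : 0 < p) (hp2 : p < 2) :
    ∃ N : Submodule ℝ (E p), IsClosed (N : Set (E p)) ∧
      Nonempty ((E p ⧸ N) ≃L[ℝ] lp (fun _ : ℕ => ℝ) 2) := by
  let N : Submodule ℝ (E p) := (quotientMap p).toLinearMap.ker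
  have hN : IsClosed (N : Set (E p)) := (quotientMap p).isClosed_ker
  have : IsClosed (N : Set (E p)) := hN
  refine ⟨N, hN, ⟨?_⟩⟩
  refine ((quotientMap p).toLinearMap.quotKerEquivOfSurjective
    (surjective_quotientMap hp0 hp2)).toContinuousLinearEquivOfContinuous ?_
  exact continuous_quot_lift _ (quotientMap p).continuous

/-! ### Sequences spanning `c₀` -/

section Sequences

variable {X : Type*} [NormedAddCommGroup X] [NormedSpace ℝ X]

/-- An upper `c₀`-estimate with constant `C`. -/
def UpperC0 (C : ℝ) (u : ℕ → X) : Prop :=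
  ∀ (s : Finset ℕ) (g : ℕ → ℝ) (M : ℝ), 0 ≤ M → (∀ k ∈ s, |g k| ≤ M) →
    ‖∑ k ∈ s, g k • u k‖ ≤ C * M

/-- A lower `c₀`-estimate with constant `c`. -/
def LowerC0 (c : ℝ) (u : ℕ → X) : Prop :=
  ∀ (s : Finset ℕ) (g : ℕ → ℝ), ∀ k ∈ s, c * |g k| ≤ ‖∑ k ∈ s, g k • u k‖

lemma EquivC0Basis.exists_upperC0 {u : ℕ → X} (h : EquivC0Basis u) :
    ∃ C : ℝ, 0 < C ∧ UpperC0 C u := by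
  classical
  obtain ⟨_, C, _, hC, h⟩ := h
  refine ⟨C, hC, fun s g M hM hg => ?_⟩
  let a : ℕ →₀ ℝ := Finsupp.indicator s fun k _ => g k
  have ha : ∀ k, a k = if k ∈ s then g k else 0 := fun k => by
    simp only [a, Finsupp.indicator_apply, dite_eq_ite]
  have h1 : (a.sum fun k t => t • u k) = ∑ k ∈ s, g k • u k := by
    rw [Finsupp.sum_of_support_subset a (Finsupp.support_indicator_subset s _) _ (by simp)]
    exact Finset.sum_congr rfl fun k hk => by rw [ha, if_pos hk]
  have h2 : ⨆ k, |a k| ≤ M := ciSup_le fun k => by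
    rw [ha]
    split_ifs with hk
    · exact hg k hk
    · simpa using hM
  rw [← h1]
  exact (h a).2.trans (by gcongr)

/-- A small perturbation: the error of a linear combination with coefficients at most `M` is at
most `M / 4`. -/
lemma norm_sum_sub_sum_le {x w : ℕ → X} {ε : ℕ → ℝ} (hε : ∀ s : Finset ℕ, ∑ k ∈ s, ε k ≤ 1 / 4)
    (hxw : ∀ k, ‖x k - w k‖ ≤ ε k) (s : Finset ℕ) {g : ℕ → ℝ} {M : ℝ} (hM : 0 ≤ M)
    (hg : ∀ k ∈ s, |g k| ≤ M) : ‖∑ k ∈ s, g k • x k - ∑ k ∈ s, g k • w k‖ ≤ M / 4 := by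
  rw [← Finset.sum_sub_distrib]
  calc ‖∑ k ∈ s, (g k • x k - g k • w k)‖ ≤ ∑ k ∈ s, M * ε k := by
        refine norm_sum_le_of_le _ fun k hk => ?_
        rw [← smul_sub, norm_smul, Real.norm_eq_abs]
        exact mul_le_mul (hg k hk) (hxw k) (norm_nonneg _) hM
    _ = M * ∑ k ∈ s, ε k := by rw [Finset.mul_sum]
    _ ≤ M * (1 / 4) := by gcongr; exact hε s
    _ = M / 4 := by ring

lemma LowerC0.of_norm_sub_le {x w : ℕ → X} {ε : ℕ → ℝ}
    (hε : ∀ s : Finset ℕ, ∑ k ∈ s, ε k ≤ 1 / 4) (hxw : ∀ k, ‖x k - w k‖ ≤ ε k)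
    (hw : LowerC0 (3 / 4) w) : LowerC0 (1 / 2) x := by
  intro s g k hk
  obtain ⟨l, hl, hmax⟩ := s.exists_max_image (fun k => |g k|) ⟨k, hk⟩
  have h1 := norm_sum_sub_sum_le hε hxw s (abs_nonneg (g l)) hmax
  have h2 := hw s g l hl
  have h3 := hmax k hk
  have h4 := norm_sub_norm_le (∑ k ∈ s, g k • w k) (∑ k ∈ s, g k • x k)
  rw [norm_sub_rev] at h4
  linarith

lemma UpperC0.of_norm_sub_le {x w : ℕ → X} {ε : ℕ → ℝ}
    (hε : ∀ s : Finset ℕ, ∑ k ∈ s, ε k ≤ 1 / 4) (hxw : ∀ k, ‖x k - w k‖ ≤ ε k) {C : ℝ}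
    (hw : UpperC0 C w) : UpperC0 (C + 1 / 4) x := by
  intro s g M hM hg
  have h1 := norm_sum_sub_sum_le hε hxw s hM hg
  have h2 := hw s g M hM hg
  have h4 := norm_sub_norm_le (∑ k ∈ s, g k • x k) (∑ k ∈ s, g k • w k)
  linarith

/-- A sequence satisfying an upper and a lower `c₀`-estimate spans a copy of `c₀`. -/
lemma exists_c0_equiv [CompleteSpace X] {Y : Submodule ℝ X} (hY : IsClosed (Y : Set X))
    {u : ℕ → X} (huY : ∀ n, u n ∈ Y) {c C : ℝ} (hc : 0 < c) (hC : 0 < C) (hup : UpperC0 C u)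
    (hlow : LowerC0 c u) : ∃ Z : Submodule ℝ X, Z ≤ Y ∧ Nonempty (C₀(ℕ, ℝ) ≃L[ℝ] Z) := by
  have hnorm : ∀ (f : C₀(ℕ, ℝ)) (n : ℕ), |f n| ≤ ‖f‖ := fun f n => f.toBCF.norm_coe_le_norm n
  have hsummable : ∀ f : C₀(ℕ, ℝ), Summable fun n => f n • u n := by
    intro f
    rw [summable_iff_vanishing_norm]
    intro ε hε
    have h0 : Tendsto f cofinite (𝓝 0) := by
      have := f.zero_at_infty'
      rwa [cocompact_eq_cofinite] at this
    have h1 : ∀ᶠ n in cofinite, |f n| < ε / (2 * C) := by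
      have := h0.abs
      rw [abs_zero] at this
      exact this.eventually_lt_const (by positivity)
    have hfin : {n | ¬ |f n| < ε / (2 * C)}.Finite := h1
    refine ⟨hfin.toFinset, fun t ht => ?_⟩
    have h2 := hup t f (ε / (2 * C)) (by positivity) fun k hk => by
      by_contra hcon
      exact Finset.disjoint_left.1 ht hk (hfin.mem_toFinset.2 fun h => hcon h.le)
    refine h2.trans_lt ?_
    rw [mul_div_assoc', mul_comm 2 C, mul_div_mul_left _ _ hC.ne']
    exact half_lt_self hε
  let T : C₀(ℕ, ℝ) →ₗ[ℝ] X :=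
    { toFun := fun f => ∑' n, f n • u n
      map_add' := fun f g => by
        rw [← (hsummable f).tsum_add (hsummable g)]
        exact tsum_congr fun n => by rw [← add_smul]; rfl
      map_smul' := fun r f => by
        rw [RingHom.id_apply, ← (hsummable f).tsum_const_smul]
        exact tsum_congr fun n => by rw [smul_smul]; rfl }
  have hT : ∀ f, HasSum (fun n => f n • u n) (T f) := fun f => (hsummable f).hasSum
  have hTle : ∀ f, ‖T f‖ ≤ C * ‖f‖ := fun f =>
    le_of_tendsto (hT f).norm (Eventually.of_forall fun s =>
      hup s f ‖f‖ (norm_nonneg _) fun k _ => hnorm f k)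
  have hTge : ∀ f, c * ‖f‖ ≤ ‖T f‖ := fun f => by
    rw [← le_div_iff₀' hc]
    refine (BoundedContinuousFunction.norm_le (f := f.toBCF) (by positivity)).2 fun n => ?_
    rw [le_div_iff₀' hc]
    refine ge_of_tendsto (hT f).norm ?_
    filter_upwards [eventually_ge_atTop {n}] with s hs
    exact hlow s f n (hs (Finset.mem_singleton_self n))
  have hinj : Function.Injective T := by
    refine (injective_iff_map_eq_zero T).2 fun f hf => ?_
    have := hTge f
    rw [hf, norm_zero] at this
    exact norm_le_zero_iff.1 (by nlinarith [norm_nonneg f])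
  refine ⟨LinearMap.range T, ?_, ⟨?_⟩⟩
  · rintro _ ⟨f, rfl⟩
    exact hY.mem_of_tendsto (hT f) (Eventually.of_forall fun s =>
      Y.sum_mem fun n _ => Y.smul_mem _ (huY n))
  · refine (LinearEquiv.ofInjective T hinj).toContinuousLinearEquivOfBounds C c⁻¹ hTle ?_
    rintro ⟨_, f, rfl⟩
    have h1 : (LinearEquiv.ofInjective T hinj).symm ⟨T f, f, rfl⟩ = f :=
      (LinearEquiv.symm_apply_eq _).2 rfl
    rw [h1, ← div_eq_inv_mul, le_div_iff₀' hc]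
    exact hTge f

end Sequences

/-! ### The gliding hump -/

lemma exists_norm_eq_one_coordE_eq_zero {p : ℝ} {Y : Submodule ℝ (E p)}
    (hY : ¬ FiniteDimensional ℝ Y) (F : Finset D) :
    ∃ y ∈ Y, ‖y‖ = 1 ∧ ∀ d ∈ F, coordE p d y = 0 := by
  let L : Y →ₗ[ℝ] (F → ℝ) := LinearMap.pi fun d => (coordE p d.1).toLinearMap ∘ₗ Y.subtype
  have hL : ¬ Function.Injective L := fun h => hY (Module.Finite.of_injective L h)
  rw [injective_iff_map_eq_zero] at hL
  push Not at hL
  obtain ⟨y, hy, hne⟩ := hL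
  have hpos : 0 < ‖(y : E p)‖ := norm_pos_iff.2 fun h => hne (Subtype.ext h)
  refine ⟨‖(y : E p)‖⁻¹ • (y : E p), Y.smul_mem _ y.2, ?_, fun d hd => ?_⟩
  · rw [norm_smul, norm_inv, norm_norm, inv_mul_cancel₀ hpos.ne']
  · have : coordE p d y = 0 := congrFun hy ⟨d, hd⟩
    rw [map_smul, this, smul_zero]

/-- The gliding hump: if normalized elements with a property `R n` can be found in `Y` so that any
given finite set of coordinates vanishes, then there is a sequence of such elements which is a
small perturbation of a disjoint sequence in `G`. -/
lemma exists_gliding_hump {p : ℝ} (hp : 0 < p) {Y : Submodule ℝ (E p)} {R : ℕ → E p → Prop}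
    (h : ∀ (n : ℕ) (F : Finset D), ∃ y ∈ Y, ‖y‖ = 1 ∧ (∀ d ∈ F, coordE p d y = 0) ∧ R n y) :
    ∃ (y : ℕ → E p) (u : ℕ → G), (∀ n, y n ∈ Y) ∧ (∀ n, ‖y n‖ = 1) ∧ (∀ n, R n (y n)) ∧
      (∀ n d, |u n d| ≤ |coordE p d (y n)|) ∧ (∀ n, tau p (u n) ≤ 1) ∧
      (∀ m n, m ≠ n → ∀ d, u m d ≠ 0 → u n d = 0) ∧
      ∀ n, ‖y n - toE p (u n)‖ ≤ 1 / 8 * (1 / 2) ^ n := by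
  classical
  have hstep : ∀ (n : ℕ) (F : Finset D), ∃ (y : E p) (F' : Finset D), F ⊆ F' ∧ y ∈ Y ∧ ‖y‖ = 1 ∧
      (∀ d ∈ F, coordE p d y = 0) ∧ R n y ∧
      ‖y - toE p (restr F' y)‖ ≤ 1 / 8 * (1 / 2) ^ n := by
    intro n F
    obtain ⟨y, hyY, hy1, hyF, hyR⟩ := h n F
    have h1 := (tendsto_toE_restr hp y).eventually
      (Metric.closedBall_mem_nhds y (show (0 : ℝ) < 1 / 8 * (1 / 2) ^ n by positivity))
    obtain ⟨F', hF', hFF'⟩ := (h1.and (eventually_ge_atTop F)).exists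
    refine ⟨y, F', hFF', hyY, hy1, hyF, hyR, ?_⟩
    rw [← dist_eq_norm, dist_comm]
    exact hF'
  choose y F' hFF' hyY hy1 hyF hyR hyε using hstep
  let F : ℕ → Finset D := fun n => Nat.rec ∅ (fun n F => F' n F) n
  have hFsucc : ∀ n, F (n + 1) = F' n (F n) := fun n => rfl
  have hFmono : Monotone F := monotone_nat_of_le_succ fun n => hFF' n (F n)
  have hzero : ∀ m n, m < n → ∀ d ∈ F (m + 1), coordE p d (y n (F n)) = 0 := fun m n hmn d hd =>
    hyF n (F n) d (hFmono (by omega : m + 1 ≤ n) hd)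
  refine ⟨fun n => y n (F n), fun n => restr (F (n + 1)) (y n (F n)), fun n => hyY n _,
    fun n => hy1 n _, fun n => hyR n _, fun n d => ?_, fun n => ?_, fun m n hmn d hd => ?_,
    fun n => hyε n _⟩
  · rw [restr_apply]
    split_ifs
    · rfl
    · simp
  · rw [← norm_toE, ← hy1 n (F n)]
    exact norm_toE_restr_le hp _ _
  · rw [restr_apply] at hd ⊢
    split_ifs with h1
    · have h2 : d ∈ F (m + 1) := by
        by_contra hcon
        simp [hcon] at hd
      rw [if_pos h2] at hd
      rcases lt_or_gt_of_ne hmn with hlt | hlt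
      · exact hzero m n hlt d h2
      · exact absurd (hzero n m hlt d h1) hd
    · rfl

lemma sum_gliding_error_le {φ : ℕ → ℕ} (hφ : Function.Injective φ) (s : Finset ℕ) :
    ∑ k ∈ s, (1 / 8 * (1 / 2 : ℝ) ^ φ k) ≤ 1 / 4 := by
  have h1 : HasSum (fun n : ℕ => 1 / 8 * (1 / 2 : ℝ) ^ n) (1 / 8 * 2) :=
    hasSum_geometric_two.mul_left _
  have h2 := sum_le_hasSum (s.map ⟨φ, hφ⟩) (fun n _ => by positivity) h1
  rw [Finset.sum_map] at h2
  refine h2.trans ?_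
  norm_num

lemma lowerC0_toE {p : ℝ} (hp : 0 < p) {u : ℕ → G} {c : ℝ} (hu : ∀ n, c ≤ tau p (u n))
    (hdisj : ∀ m n, m ≠ n → ∀ d, u m d ≠ 0 → u n d = 0) :
    LowerC0 c fun n => toE p (u n) := by
  classical
  intro s g k hk
  have h1 : ∑ k ∈ s, g k • toE p (u k) = toE p (∑ k ∈ s, g k • u k) := by
    rw [map_sum]
    simp only [map_smul]
  rw [h1, norm_toE]
  have h2 : tau p (g k • u k) ≤ tau p (∑ k ∈ s, g k • u k) := by
    refine tau_mono hp fun d => ?_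
    by_cases hd : u k d = 0
    · simp [hd]
    · rw [Finsupp.finsetSum_apply, Finset.sum_eq_single_of_mem k hk]
      intro l _ hl
      rw [Finsupp.smul_apply, hdisj k l hl.symm d hd, smul_zero]
  rw [tau_smul] at h2
  calc c * |g k| ≤ tau p (u k) * |g k| := by gcongr; exact hu k
    _ = |g k| * tau p (u k) := mul_comm _ _
    _ ≤ _ := h2

/-- The space `E` is `c₀`-saturated. Either the norm is equivalent to the sup-norm of the
coordinates on a subspace of finite codimension, and then any gliding hump sequence spans `c₀`; or
there is a gliding hump sequence whose sup-norms tend to zero. -/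
theorem c0Saturated_E {p : ℝ} (hp : 1 < p) : C0Saturated (E p) := by
  classical
  have hp0 : 0 < p := by linarith
  intro Y hYc hYinf
  by_cases hcase : ∃ (F₀ : Finset D) (C : ℝ), 0 < C ∧ ∀ y ∈ Y, (∀ d ∈ F₀, coordE p d y = 0) →
      ∀ s : ℝ, (∀ d, |coordE p d y| ≤ s) → ‖y‖ ≤ C * s
  · obtain ⟨F₀, C, hC, hCY⟩ := hcase
    obtain ⟨y, u, hyY, hy1, hyF, huy, -, hdisj, hyu⟩ := exists_gliding_hump hp0 (Y := Y)
      (R := fun _ y => ∀ d ∈ F₀, coordE p d y = 0) fun n F => by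
        obtain ⟨y, hy, hy1, hyF⟩ := exists_norm_eq_one_coordE_eq_zero hYinf (F ∪ F₀)
        exact ⟨y, hy, hy1, fun d hd => hyF d (Finset.mem_union_left _ hd),
          fun d hd => hyF d (Finset.mem_union_right _ hd)⟩
    have hε := sum_gliding_error_le (φ := id) Function.injective_id
    have htau : ∀ n, 3 / 4 ≤ tau p (u n) := fun n => by
      have h1 := norm_sub_norm_le (y n) (toE p (u n))
      have h2 := hε {n}
      rw [Finset.sum_singleton] at h2
      have h3 := hyu n
      rw [hy1, norm_toE] at h1
      simp only [id] at h2
      linarith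
    refine exists_c0_equiv hYc hyY (c := 1 / 2) (C := C * (5 / 4)) (by norm_num) (by positivity)
      ?_ ((lowerC0_toE hp0 htau hdisj).of_norm_sub_le hε hyu)
    intro s g M hM hg
    rw [mul_assoc]
    refine hCY _ (Y.sum_mem fun k _ => Y.smul_mem _ (hyY k)) (fun d hd => ?_) _ fun d => ?_
    · rw [map_sum]
      exact Finset.sum_eq_zero fun k _ => by rw [map_smul, hyF k d hd, smul_zero]
    · have h1 := norm_sum_sub_sum_le hε hyu s hM hg
      have h2 := (abs_coordE_le p d _).trans h1
      rw [map_sub] at h2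
      have h3 : |coordE p d (∑ k ∈ s, g k • toE p (u k))| ≤ M := by
        simp only [map_sum, map_smul, coordE_toE]
        by_cases hk : ∃ k ∈ s, u k d ≠ 0
        · obtain ⟨k, hks, hk⟩ := hk
          rw [Finset.sum_eq_single_of_mem k hks fun l _ hl => by
            rw [hdisj k l hl.symm d hk, smul_zero], smul_eq_mul, abs_mul]
          calc |g k| * |u k d| ≤ M * 1 := by
                gcongr
                · exact hg k hks
                · exact (huy k d).trans ((abs_coordE_le p d _).trans_eq (hy1 k))
            _ = M := mul_one M
        · push Not at hk
          rw [Finset.sum_eq_zero fun k hks => by rw [hk k hks, smul_zero], abs_zero]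
          exact hM
      have h4 := abs_sub_abs_le_abs_sub (coordE p d (∑ k ∈ s, g k • y k))
        (coordE p d (∑ k ∈ s, g k • toE p (u k)))
      linarith
  · push Not at hcase
    obtain ⟨y, u, hyY, hy1, hyR, huy, hu1, hdisj, hyu⟩ := exists_gliding_hump hp0 (Y := Y)
      (R := fun n y => ∀ d, |coordE p d y| ≤ 1 / ((n : ℝ) + 1)) fun n F => by
        obtain ⟨y, hy, hyF, s, hys, hs⟩ := hcase F ((n : ℝ) + 1) (by positivity)
        have hs0 : 0 ≤ s := (abs_nonneg _).trans (hys ⟨(1, 1), le_rfl⟩)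
        have hpos : 0 < ‖y‖ := lt_of_le_of_lt (by positivity) hs
        refine ⟨‖y‖⁻¹ • y, Y.smul_mem _ hy, ?_, fun d hd => ?_, fun d => ?_⟩
        · rw [norm_smul, norm_inv, norm_norm, inv_mul_cancel₀ hpos.ne']
        · rw [map_smul, hyF d hd, smul_zero]
        · rw [map_smul, smul_eq_mul, abs_mul, abs_of_pos (inv_pos.2 hpos), ← div_eq_inv_mul,
            div_le_div_iff₀ hpos (by positivity), one_mul]
          have := hys d
          nlinarith [(Nat.cast_nonneg n : (0 : ℝ) ≤ n)]
    have htau : ∀ n, 3 / 4 ≤ tau p (u n) := fun n => by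
      have h1 := norm_sub_norm_le (y n) (toE p (u n))
      have h2 := sum_gliding_error_le Function.injective_id {n}
      rw [Finset.sum_singleton] at h2
      have h3 := hyu n
      rw [hy1, norm_toE] at h1
      simp only [id] at h2
      linarith
    have htau0 : ∀ n, 0 < tau p (u n) := fun n => by linarith [htau n]
    obtain ⟨φ, hφ, hequiv⟩ := exists_subseq_equivC0Basis hp (y := fun n => (tau p (u n))⁻¹ • u n)
      (fun n => by
        rw [tau_smul, abs_of_pos (inv_pos.2 (htau0 n)), inv_mul_cancel₀ (htau0 n).ne'])
      (fun m n hmn d hd => by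
        have : u m d ≠ 0 := fun h => hd (by simp [h])
        simp [hdisj m n hmn d this])
      (fun ε hε => by
        have h1 : ∀ᶠ n : ℕ in atTop, 1 / ((n : ℝ) + 1) ≤ 3 / 4 * ε :=
          tendsto_one_div_add_atTop_nhds_zero_nat.eventually_le_const (by positivity)
        filter_upwards [h1] with n hn d
        rw [Finsupp.smul_apply, smul_eq_mul, abs_mul, abs_of_pos (inv_pos.2 (htau0 n)),
          ← div_eq_inv_mul, div_le_iff₀ (htau0 n)]
        have h2 := (huy n d).trans ((hyR n d).trans hn)
        nlinarith [htau n])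
    obtain ⟨C, hC, hup⟩ := hequiv.exists_upperC0
    have hup' : UpperC0 C fun k => toE p (u (φ k)) := by
      intro s g M hM hg
      have h1 : ∑ k ∈ s, g k • toE p (u (φ k)) = ∑ k ∈ s,
          (g k * tau p (u (φ k))) • toE p ((tau p (u (φ k)))⁻¹ • u (φ k)) := by
        refine Finset.sum_congr rfl fun k _ => ?_
        rw [map_smul, smul_smul, mul_assoc, mul_inv_cancel₀ (htau0 _).ne', mul_one]
      rw [h1]
      refine hup s (fun k => g k * tau p (u (φ k))) M hM fun k hk => ?_
      rw [abs_mul, abs_of_pos (htau0 _)]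
      calc |g k| * tau p (u (φ k)) ≤ M * 1 :=
            mul_le_mul (hg k hk) (hu1 _) (htau0 _).le hM
        _ = M := mul_one M
    have hε := sum_gliding_error_le hφ.injective
    exact exists_c0_equiv hYc (fun k => hyY (φ k)) (c := 1 / 2) (C := C + 1 / 4) (by norm_num)
      (by positivity) (hup'.of_norm_sub_le hε fun k => hyu (φ k))
      ((lowerC0_toE hp0 (fun k => htau (φ k)) fun m n hmn =>
        hdisj _ _ (hφ.injective.ne hmn)).of_norm_sub_le hε fun k => hyu (φ k))

lemma abs_apply_le_supNorm (x : G) (d : D) : |x d| ≤ supNorm x := by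
  classical
  refine le_ciSup (f := fun d => |x d|) ?_ d
  refine (Set.Finite.subset ((x.support.image fun d => |x d|) ∪ {0}).finite_toSet ?_).bddAbove
  rintro _ ⟨e, rfl⟩
  by_cases he : x e = 0
  · simp [he]
  · exact Finset.mem_coe.2 (Finset.mem_union_left _
      (Finset.mem_image.2 ⟨e, Finsupp.mem_support_iff.2 he, rfl⟩))

end Leung

theorem mainTheorem1 (p : ℝ) (hp1 : 1 < p) (hp2 : p < 2) :
    (∀ y : ℕ → Leung.G,
      (∀ n, ‖Leung.toE p (y n)‖ = 1) →
      (Pairwise fun m n => |y m| ⊓ |y n| = 0) →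
      Tendsto (fun n => Leung.supNorm (y n)) atTop (𝓝 0) →
      ∃ φ : ℕ → ℕ, StrictMono φ ∧ Leung.EquivC0Basis fun k => Leung.toE p (y (φ k))) ∧
    Leung.C0Saturated (Leung.E p) ∧
    (∃ b : UnconditionalSchauderBasis Leung.D ℝ (Leung.E p),
      ∀ d, b d = Leung.toE p (Finsupp.single d 1)) ∧
    (∃ N : Submodule ℝ (Leung.E p), IsClosed (N : Set (Leung.E p)) ∧
      Nonempty ((Leung.E p ⧸ N) ≃L[ℝ] lp (fun _ : ℕ => ℝ) 2)) := by
  have hp0 : 0 < p := by linarith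
  refine ⟨fun y hy hdisj hsup => ?_, Leung.c0Saturated_E hp1,
    ⟨Leung.unitVectorBasis hp0, fun d => rfl⟩, Leung.exists_quotient_equiv_L2 hp0 hp2⟩
  refine Leung.exists_subseq_equivC0Basis hp1 (fun n => ?_) (fun m n hmn d hd => ?_)
    fun ε hε => ?_
  · rw [← Leung.norm_toE]
    exact hy n
  · have h1 := DFunLike.congr_fun (hdisj hmn) d
    rw [Finsupp.inf_apply, Leung.abs_apply, Leung.abs_apply, Finsupp.zero_apply] at h1
    rcases min_choice |y m d| |y n d| with h2 | h2
    · exact absurd (abs_eq_zero.1 (h2.symm.trans h1)) hd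
    · exact abs_eq_zero.1 (h2.symm.trans h1)
  · filter_upwards [hsup.eventually_le_const hε] with n hn d
    exact (Leung.abs_apply_le_supNorm (y n) d).trans hn
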